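/- **Lemma.** Let $M$ be a connected $3$-manifold whose boundary is a single torus $T=\partial M$, and let $m,l$ (a meridian and a longitude) be simple closed curves on $T$ that give an identification $T\cong S^1\times S^1$, $m=S^1\times 1$, $l=1\times S^1$; so $H_1(T;\mathbb Z)=\mathbb Z m\oplus\mathbb Z l$. Suppose that $l$ is trivial in $H_1(M;\mathbb R)$, and let $S$ be a compact connected oriented surface with a map $(S,\partial S)\to (M,T)$ that bounds $n\ge 1$ times the longitude, i.e. the image of $[\partial S]$ in $H_1(T;\mathbb Z)$ is $n\,l$ (for instance, such a surface of least genus). Put $\chi_{\mathbb Q}=\chi(S)/n$. For coprime integers $p,q$ with $p>0$ let $M(p/q)$ be the Dehn filling of $M$ along the slope $pm+ql$, i.e. $M\cup (D^2\times S^1)$ glued by a homeomorphism $\partial D^2\times S^1\to T$ that takes $\partial D^2\times 1$ to a curve in the class $pm+ql$. Let $a(p/q)\in\pi_1(M(p/q))$ be an element in the conjugacy class of the core circle $0\times S^1$ of the filling solid torus. Assume that $\chi(S)\le 0$ or that $a(p/q)$ has infinite order (the latter holds whenever $M(p/q)$ is hyperbolic and the core is homotopic to a closed geodesic). Then $$\mathrm{scl}(a(p/q))\le\frac{-\chi_{\mathbb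 Q}}{2p},$$ where $\mathrm{scl}(a)=\liminf_{k\to\infty}\mathrm{cl}(a^k)/k$, and $\mathrm{cl}(b)\in[0,\infty]$ is the least number of commutators whose product is $b$ ($\infty$ if there are none). -/

import Mathlib

open scoped Manifold unitInterval

noncomputable section

namespace DehnScl

/-! ### Stable commutator length -/

/-- The commutator length of `a`: the least number of commutators whose product is `a`,
and `⊤` if `a` is not a product of commutators. -/
def cl {G : Type*} [Group G] (a : G) : ℕ∞ :=
  ⨅ (L : List G) (_ : (∀ c ∈ L, c ∈ commutatorSet G) ∧ L.prod = a), (L.length : ℕ∞)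

/-- The stable commutator length `liminf cl (a ^ n) / n`, with values in `[0, ∞]`. -/
def scl {G : Type*} [Group G] (a : G) : ENNReal :=
  Filter.liminf (fun n : ℕ => ((cl (a ^ n) : ℕ∞) : ENNReal) / (n : ENNReal)) Filter.atTop

/-! ### Compact connected oriented surfaces, presented by triangulations -/

/-- A connected oriented triangulated surface (possibly with boundary) on the vertex set `V`.
`tri u v w` says that `u, v, w` span a triangle and that the cyclic order `u → v → w → u` is its
positive one. A directed edge `u → v` is on the boundary of at most one positively oriented
triangle: hence an edge lies in at most two triangles, and if it lies in two, they induce opposite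
directions on it. The link of a vertex is connected, so it is an arc or a circle. -/
structure OrientedSurface (V : Type*) [Fintype V] where
  tri : V → V → V → Prop
  rotate : ∀ {u v w}, tri u v w → tri v w u
  ne : ∀ {u v w}, tri u v w → u ≠ v
  not_flip : ∀ {u v w}, tri u v w → ¬ tri v u w
  coherent : ∀ {u v w w'}, tri u v w → tri u v w' → w = w'
  pure : ∀ v, ∃ u w, tri v u w
  link_connected : ∀ v u u', (∃ w, tri v u w ∨ tri v w u) → (∃ w, tri v u' w ∨ tri v w u') →
    Relation.EqvGen (tri v) u u'
  connected : ∀ u v, Relation.EqvGen (fun x y => ∃ z, tri x y z) u v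

namespace OrientedSurface

variable {V : Type*} [Fintype V] (K : OrientedSurface V)

/-- The edges, as two-element sets of vertices. -/
def edges : Set (Set V) := {s | ∃ u v w, K.tri u v w ∧ s = {u, v}}

/-- The triangles, as three-element sets of vertices. -/
def triangles : Set (Set V) := {s | ∃ u v w, K.tri u v w ∧ s = {u, v, w}}

/-- The Euler characteristic: vertices minus edges plus triangles. -/
def eulerChar : ℤ :=
  (Fintype.card V : ℤ) - (K.edges.ncard : ℤ) + (K.triangles.ncard : ℤ)

/-- The underlying topological space (geometric realization), in barycentric coordinates. -/
def Realization : Type _ :=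
  {x : V → ℝ // x ∈ stdSimplex ℝ V ∧
    ∃ u v w, K.tri u v w ∧ ∀ z, x z ≠ 0 → z = u ∨ z = v ∨ z = w}

instance : TopologicalSpace K.Realization := instTopologicalSpaceSubtype

/-- `u → v` is a boundary edge with its boundary orientation: it is a directed side of a positively
oriented triangle, and there is no triangle on its other side. -/
def IsBoundaryEdge (u v : V) : Prop := (∃ w, K.tri u v w) ∧ ¬ ∃ w, K.tri v u w

/-- The boundary edges, each with its boundary orientation. -/
def BoundaryEdge : Type _ := {e : V × V // K.IsBoundaryEdge e.1 e.2}

instance : Finite K.BoundaryEdge := Subtype.finite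

instance : Fintype K.BoundaryEdge := Fintype.ofFinite _

open Classical in
/-- The point `(1 - t) u + t v`, in barycentric coordinates. -/
def edgePoint (u v : V) (t : I) : V → ℝ :=
  fun z => (1 - (t : ℝ)) * (if z = u then 1 else 0) + (t : ℝ) * (if z = v then 1 else 0)

/-- The straight path along a boundary edge. The boundary of the surface is the union of the images
of these paths. -/
def edgePath (e : K.BoundaryEdge) : C(I, K.Realization) where
  toFun t := ⟨edgePoint e.1.1 e.1.2 t, by
    obtain ⟨⟨u, v⟩, ⟨w, hw⟩, -⟩ := e
    refine ⟨⟨fun z => ?_, ?_⟩, u, v, w, hw, fun z hz => ?_⟩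
    · have h0 := t.2.1
      have h1 := sub_nonneg.2 t.2.2
      simp only [edgePoint]
      positivity
    · classical
      simp only [edgePoint, Finset.sum_add_distrib, ← Finset.mul_sum]
      simp
    · by_contra! h
      exact hz (by simp [edgePoint, h.1, h.2.1])⟩
  continuous_toFun := by
    refine Continuous.subtype_mk (continuous_pi fun z => ?_) _
    unfold edgePoint
    fun_prop

end OrientedSurface

/-! ### Homology classes on a marked torus -/

theorem exists_circle_lift (c : C(I, Circle)) :
    ∃ θ : C(I, ℝ), ∀ t, Circle.exp (2 * Real.pi * θ t) = c t := by
  have hT : (2 * Real.pi) ≠ 0 := by positivity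
  let e := AddCircle.homeomorphCircle hT
  obtain ⟨x, hx⟩ := QuotientAddGroup.mk_surjective (e.symm (c 0))
  obtain ⟨Γ, hΓ, -⟩ := (AddCircle.isCoveringMap_coe (2 * Real.pi)).exists_path_lifts
    ((e.symm : C(Circle, AddCircle (2 * Real.pi))).comp c) x hx.symm
  refine ⟨⟨fun t => Γ t / (2 * Real.pi), by fun_prop⟩, fun t => ?_⟩
  have h : ((Γ t : ℝ) : AddCircle (2 * Real.pi)) = e.symm (c t) := congrFun hΓ t
  have h2 : e (Γ t : AddCircle (2 * Real.pi)) = c t := by rw [h]; simp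
  rw [← h2]
  simp only [ContinuousMap.coe_mk, mul_div_cancel₀ _ hT]
  simp [e, AddCircle.homeomorphCircle_apply, AddCircle.toCircle_apply_mk]

/-- The number of turns (a real number) that a path in the circle makes around the circle, i.e. the
increment of a continuous choice of angle, divided by `2π`. For a loop it is the winding number. -/
def turns (c : C(I, Circle)) : ℝ :=
  (exists_circle_lift c).choose 1 - (exists_circle_lift c).choose 0

/-- The loop `t ↦ exp (2πit)` once around the circle. -/
def circleLoop : C(I, Circle) where
  toFun t := Circle.exp (2 * Real.pi * (t : ℝ))
  continuous_toFun := by fun_prop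

section Torus

variable {X : Type*} [TopologicalSpace X] {T : Set X}

/-- Let `φ : S¹ × S¹ ≃ T` be a marking of a torus by a meridian `m = φ(S¹ × 1)` and a longitude
`l = φ(1 × S¹)`. The pair of numbers of turns of a path in `T` along `m` and `l`. Summed over
the pieces of a `1`-cycle, it gives the coordinates `(x, y)` of its class `x m + y l` in
`H₁(T; ℤ) = ℤ m ⊕ ℤ l`. -/
def torusTurns (φ : Circle × Circle ≃ₜ T) (c : C(I, T)) : ℝ × ℝ :=
  (turns ⟨fun t => (φ.symm (c t)).1, by fun_prop⟩,
   turns ⟨fun t => (φ.symm (c t)).2, by fun_prop⟩)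

/-- The map `f` of the surface `K` sends the boundary of `K` into the torus `T`, and the oriented
boundary represents `n` times the longitude in the first homology of `T`. -/
def BoundsLongitude (φ : Circle × Circle ≃ₜ T) {V : Type*} [Fintype V] (K : OrientedSurface V)
    (f : C(K.Realization, X)) (n : ℕ) : Prop :=
  ∃ hf : ∀ (e : K.BoundaryEdge) (t : I), f (K.edgePath e t) ∈ T,
    ∑ e : K.BoundaryEdge, torusTurns φ ⟨fun t => ⟨f (K.edgePath e t), hf e t⟩, by fun_prop⟩ =
      (0, (n : ℝ))

/-! ### Dehn filling -/

/-- The solid torus `D² × S¹`. -/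
abbrev SolidTorus : Type := Metric.closedBall (0 : ℂ) 1 × Circle

/-- The inclusion of `∂D² × S¹` in the solid torus. -/
def solidTorusBoundary (x : Circle × Circle) : SolidTorus :=
  (⟨(x.1 : ℂ), by simp [Circle.norm_coe]⟩, x.2)

/-- The identification of `∂D² × S¹` with the torus `T` along `h`. -/
inductive GlueRel (h : Circle × Circle ≃ₜ T) : X ⊕ SolidTorus → X ⊕ SolidTorus → Prop
  | glue (x : Circle × Circle) : GlueRel h (Sum.inl (h x : X)) (Sum.inr (solidTorusBoundary x))

/-- The Dehn filling `X ∪ (D² × S¹)` of `X` with gluing map `h : ∂D² × S¹ ≃ T`. -/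
def Filling (h : Circle × Circle ≃ₜ T) : Type _ := Quot (GlueRel h)

instance (h : Circle × Circle ≃ₜ T) : TopologicalSpace (Filling h) :=
  instTopologicalSpaceQuot

/-- The gluing map `h` sends the meridian `∂D² × 1` of the solid torus to a curve in the class
`p m + q l` of `H₁(T; ℤ)`, so that the filling along `h` is the `p/q` filling. -/
def HasSlope (φ h : Circle × Circle ≃ₜ T) (p q : ℤ) : Prop :=
  torusTurns φ ⟨fun t => h (circleLoop t, 1), by fun_prop⟩ = ((p : ℝ), (q : ℝ))

/-- The point `(0, x)` on the core circle of the filling solid torus. -/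
def corePoint (h : Circle × Circle ≃ₜ T) (x : Circle) : Filling h :=
  Quot.mk _ (Sum.inr (⟨0, by simp⟩, x))

/-- The core circle of the filling solid torus, as a loop. -/
def coreLoop (h : Circle × Circle ≃ₜ T) : Path (corePoint h 1) (corePoint h 1) where
  toFun t := corePoint h (circleLoop t)
  continuous_toFun := by
    unfold corePoint
    exact continuous_quot_mk.comp (by fun_prop)
  source' := by simp [circleLoop]
  target' := by simp [circleLoop]

/-- `a ∈ π₁(Filling h, x)` is in the conjugacy class determined by the core circle: for some path
`δ` from the core circle to the base point, `a` is the class of the loop `δ⁻¹ · core · δ`. -/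
def IsCoreClass (h : Circle × Circle ≃ₜ T) {x : Filling h} (a : FundamentalGroup (Filling h) x) :
    Prop :=
  ∃ δ : Path (corePoint h 1) x,
    a = FundamentalGroup.fundamentalGroupMulEquivOfPath δ
      (FundamentalGroup.fromPath (Path.Homotopic.Quotient.mk (coreLoop h)))

end Torus

end DehnScl

end

/-! Include the surface in the filling. Its boundary now runs on the boundary of a solid torus, so
every boundary arc, closed up inside the solid torus, is a power of the core `a`. The total exponent
`N` is the number of turns of the whole boundary around the core. It is homological, so it depends
only on the class `n l`. The meridian of the solid torus makes no turns. As its class is `p m + q l`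
with `p`, `q` coprime, the number of turns of `l` is a multiple of `p`, and it is nonzero because
some loop on the torus turns once. Hence `|N| ≥ n p`.

A surface of genus `g` with `b` boundary circles gives a relation: a product of `g` commutators and
`b` conjugates of powers of `a` equals `1`. Its complexity `r = 2 g + b` is `2 - χ`; only `r ≤ 2 -
χ` is needed (`exists_surfaceRel`). The classification of surfaces is not used. The triangles are
unfolded along a dual tree into a polygon (`IsGluing`), and the boundary word is reduced by surgery
on pairs of glued sides (`IsPolygon.surfaceRel`). Homotopy enters only through a cocycle on the
edges with values in the fundamental group.

The bound on scl is algebraic and takes the place of finite covers of the surface. Writing `⁅u, v⁆`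
as `u` times a conjugate of `u⁻¹` turns the relation into `r` letters with product `1`. Passing from
`(x y) ^ (2 k + 1)` to the product of the powers costs `k + 1` commutators (`mul_pow`), so the
product of the `(2 k + 1)`-st powers of the letters costs about `(r - 2) k`. Up to boundedly many
commutators that product is `a ^ ((2 k + 1) N)`. Dividing by the exponent gives `scl a ≤ (r - 2) /
(2 |N|)`.

If `χ > 0` then `r ≤ 1`, and the relation says `a ^ N = 1`; this is what the disjunction in the
hypotheses excludes. -/

namespace DehnScl

open scoped commutatorElement

/-! ### Counting commutators in products of powers -/

section Algebra

variable {G : Type*} [Group G]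

/-- Cutting a handle: removing an interlaced pair of letters costs one commutator. -/
theorem handle_eq (A x B y C D E : G) : A * x * B * y * C * x⁻¹ * D * y⁻¹ * E =
    (A * D * C) * ⁅(A * D * C)⁻¹ * (A * x), B * y * C⁆ * (A * D * C)⁻¹ * (A * D * C * B * E) := by
  simp only [commutatorElement_def]; group

/-- `g` is a product of at most `n` commutators. -/
def IsCommProd (n : ℕ) (g : G) : Prop :=
  ∃ L : List G, (∀ c ∈ L, c ∈ commutatorSet G) ∧ L.prod = g ∧ L.length ≤ n

namespace IsCommProd

theorem one (n : ℕ) : IsCommProd n (1 : G) := ⟨[], by simp, by simp, by simp⟩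

theorem mono {m n : ℕ} {g : G} (h : IsCommProd m g) (hmn : m ≤ n) : IsCommProd n g := by
  obtain ⟨L, h1, h2, h3⟩ := h
  exact ⟨L, h1, h2, h3.trans hmn⟩

theorem comm (x y : G) : IsCommProd 1 ⁅x, y⁆ :=
  ⟨[⁅x, y⁆], by simp [commutator_mem_commutatorSet], by simp, by simp⟩

theorem mul {m n : ℕ} {x y : G} (hx : IsCommProd m x) (hy : IsCommProd n y) :
    IsCommProd (m + n) (x * y) := by
  obtain ⟨L, h1, h2, h3⟩ := hx
  obtain ⟨L', h1', h2', h3'⟩ := hy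
  refine ⟨L ++ L', ?_, by simp [h2, h2'], by simp; omega⟩
  intro c hc
  rcases List.mem_append.1 hc with hc | hc
  exacts [h1 c hc, h1' c hc]

theorem map {H : Type*} [Group H] (φ : G →* H) {n : ℕ} {x : G} (hx : IsCommProd n x) :
    IsCommProd n (φ x) := by
  obtain ⟨L, h1, rfl, h3⟩ := hx
  refine ⟨L.map φ, ?_, by simp [map_list_prod], by simpa using h3⟩
  intro c hc
  obtain ⟨d, hd, rfl⟩ := List.mem_map.1 hc
  obtain ⟨u, v, rfl⟩ := h1 d hd
  exact ⟨φ u, φ v, by simp [map_commutatorElement]⟩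

theorem conj (t : G) {n : ℕ} {x : G} (hx : IsCommProd n x) : IsCommProd n (t * x * t⁻¹) := by
  simpa using hx.map (MulAut.conj t).toMonoidHom

theorem of_conj (t : G) {n : ℕ} {x : G} (hx : IsCommProd n (t * x * t⁻¹)) : IsCommProd n x := by
  simpa [mul_assoc] using hx.conj t⁻¹

theorem swap {n : ℕ} {x y : G} (hx : IsCommProd n (x * y)) : IsCommProd n (y * x) := by
  simpa [mul_assoc] using hx.conj y

theorem inv {n : ℕ} {x : G} (hx : IsCommProd n x) : IsCommProd n x⁻¹ := by
  obtain ⟨L, h1, rfl, h3⟩ := hx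
  refine ⟨(L.map (·⁻¹)).reverse, ?_, (List.prod_inv_reverse L).symm, by simpa using h3⟩
  intro c hc
  simp only [List.mem_reverse, List.mem_map] at hc
  obtain ⟨d, hd, rfl⟩ := hc
  obtain ⟨u, v, rfl⟩ := h1 d hd
  exact ⟨v, u, by simp⟩

/-- The odd powers of a product differ from the product of the powers by about half as many
commutators as the exponent. -/
theorem mul_pow_aux (x y : G) (k : ℕ) :
    IsCommProd k ((y ^ k)⁻¹ * (x * y) ^ (2 * k + 1) * (y ^ (k + 1))⁻¹ * (x ^ (2 * k + 1))⁻¹) := by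
  induction k with
  | zero => simpa using one 0
  | succ k ih =>
    set U := (y ^ k)⁻¹ * (x * y) ^ (2 * k + 1) with hU
    set W := (y ^ (k + 1))⁻¹ * (x ^ (2 * k + 1))⁻¹ with hW
    -- This is what `handle_eq` leaves after the interlaced `x` and `y` are removed. It equals `W *
    -- U`, a cyclic rotation of the word in the induction hypothesis.
    have h : IsCommProd k (1 * x⁻¹ * (x * W) * 1 * U) := by
      rw [one_mul, inv_mul_cancel_left, mul_one]
      exact swap (by simpa only [hW, mul_assoc] using ih)
    have e : (y ^ (k + 1))⁻¹ * (x * y) ^ (2 * (k + 1) + 1) * (y ^ (k + 1 + 1))⁻¹ *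
        (x ^ (2 * (k + 1) + 1))⁻¹ = y⁻¹ * (U * (x * y * x) * W * x⁻¹ * x⁻¹) := by
      have a1 : (y ^ (k + 1))⁻¹ = y⁻¹ * (y ^ k)⁻¹ := by rw [pow_succ, mul_inv_rev]
      have a2 : (x * y) ^ (2 * (k + 1) + 1) = (x * y) ^ (2 * k + 1) * (x * y * (x * y)) := by
        rw [show 2 * (k + 1) + 1 = (2 * k + 1) + 2 by ring, pow_add, sq]
      have a3 : (y ^ (k + 1 + 1))⁻¹ = y⁻¹ * (y ^ (k + 1))⁻¹ := by rw [pow_succ, mul_inv_rev]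
      have a4 : (x ^ (2 * (k + 1) + 1))⁻¹ = (x ^ (2 * k + 1))⁻¹ * x⁻¹ * x⁻¹ := by
        rw [show 2 * (k + 1) + 1 = 2 + (2 * k + 1) by ring, pow_add, mul_inv_rev, sq, mul_inv_rev,
          mul_assoc]
      rw [a2, a3, a4, hU, hW]
      nth_rewrite 1 [a1]
      simp only [mul_assoc, mul_inv_cancel_left]
    rw [e]
    apply of_conj (U⁻¹ * y)
    have e2 : U⁻¹ * y * (y⁻¹ * (U * (x * y * x) * W * x⁻¹ * x⁻¹)) * (U⁻¹ * y)⁻¹ =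
        1 * x * 1 * y * (x * W) * x⁻¹ * x⁻¹ * y⁻¹ * U := by group
    rw [e2, handle_eq, add_comm]
    exact ((comm _ _).conj _).mul h

/-- In `mul_pow_aux` the powers of `y` are distributed on both sides to keep the induction cheap.
Bringing them together costs a conjugation and one more commutator. -/
theorem mul_pow (x y : G) (k : ℕ) :
    IsCommProd (k + 1) ((x * y) ^ (2 * k + 1) * (x ^ (2 * k + 1) * y ^ (2 * k + 1))⁻¹) := by
  have h := (mul_pow_aux x y k).conj (y ^ k)
  have e : (x * y) ^ (2 * k + 1) * (x ^ (2 * k + 1) * y ^ (2 * k + 1))⁻¹ =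
      (y ^ k * ((y ^ k)⁻¹ * (x * y) ^ (2 * k + 1) * (y ^ (k + 1))⁻¹ * (x ^ (2 * k + 1))⁻¹) *
        (y ^ k)⁻¹) * ⁅y ^ k, x ^ (2 * k + 1)⁆ := by
    have : y ^ (2 * k + 1) = y ^ k * y ^ (k + 1) := by rw [← pow_add]; congr 1; ring
    simp only [commutatorElement_def, this, mul_inv_rev, mul_assoc, mul_inv_cancel_left,
      inv_mul_cancel_left]
  rw [e]
  exact h.mul (comm _ _)

/-- Each letter but the last is split off by one use of `mul_pow`, hence the factor `length - 1`. -/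
theorem list_prod_pow (k : ℕ) (ys : List G) :
    IsCommProd ((ys.length - 1) * (k + 1))
      (ys.prod ^ (2 * k + 1) * ((ys.map (· ^ (2 * k + 1))).prod)⁻¹) := by
  induction ys with
  | nil => simpa using one 0
  | cons y ys ih =>
    rcases ys with _ | ⟨z, ys⟩
    · simpa using one _
    · set zs := z :: ys
      have e : (y :: zs).prod ^ (2 * k + 1) * (((y :: zs).map (· ^ (2 * k + 1))).prod)⁻¹ =
          ((y * zs.prod) ^ (2 * k + 1) * (y ^ (2 * k + 1) * zs.prod ^ (2 * k + 1))⁻¹) *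
          (y ^ (2 * k + 1) * (zs.prod ^ (2 * k + 1) * ((zs.map (· ^ (2 * k + 1))).prod)⁻¹) *
            (y ^ (2 * k + 1))⁻¹) := by
        simp only [List.prod_cons, List.map_cons]; group
      rw [e]
      refine ((mul_pow _ _ k).mul (ih.conj _)).mono (le_of_eq ?_)
      simp [zs]; ring

end IsCommProd

/-! ### Relations of surface type and the resulting bound on scl -/

/-- `SurfaceRel a r N w` says that `w` is a product of conjugates of powers of `a` and of commutators,
where the exponents of `a` sum up to `N`, and `r` is the number of powers plus twice the number of
commutators. -/
inductive SurfaceRel (a : G) : ℕ → ℤ → G → Prop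
  | one : SurfaceRel a 0 0 1
  | zpow (k : ℤ) : SurfaceRel a 1 k (a ^ k)
  | comm (u v : G) : SurfaceRel a 2 0 ⁅u, v⁆
  | mul {r s : ℕ} {M N : ℤ} {x y : G} : SurfaceRel a r M x → SurfaceRel a s N y →
      SurfaceRel a (r + s) (M + N) (x * y)
  | conj {r : ℕ} {N : ℤ} {x : G} (t : G) : SurfaceRel a r N x → SurfaceRel a r N (t * x * t⁻¹)

namespace SurfaceRel

variable {a : G}

theorem eq_of_zero {r : ℕ} {N : ℤ} {w : G} (h : SurfaceRel a r N w) :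
    r = 0 → N = 0 ∧ w = 1 := by
  induction h with
  | one => simp
  | zpow => simp
  | comm => simp
  | mul _ _ h1 h2 =>
    intro h
    obtain ⟨rfl, rfl⟩ := h1 (by omega)
    obtain ⟨rfl, rfl⟩ := h2 (by omega)
    simp
  | conj t _ h1 =>
    intro h
    obtain ⟨rfl, rfl⟩ := h1 h
    simp

/-- The case of a sphere or a disc: there is no room for a commutator or a second power. It serves
to exclude positive Euler characteristic. -/
theorem isConj_of_le_one {r : ℕ} {N : ℤ} {w : G} (h : SurfaceRel a r N w) :
    r ≤ 1 → IsConj w (a ^ N) := by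
  induction h with
  | one => simp
  | zpow k => exact fun _ => IsConj.refl _
  | comm => simp
  | @mul r s M N x y hx hy h1 h2 =>
    intro h
    rcases Nat.eq_zero_or_pos r with hr | hr
    · obtain ⟨rfl, rfl⟩ := hx.eq_of_zero hr
      simpa using h2 (by omega)
    · obtain ⟨rfl, rfl⟩ := hy.eq_of_zero (by omega)
      simpa using h1 (by omega)
  | conj t _ h1 =>
    intro h
    exact IsConj.trans (isConj_iff.2 ⟨t⁻¹, by group⟩) (h1 h)

/-- A commutator counts as the two letters `u` and `v u⁻¹ v⁻¹`, whose `m`-th powers multiply to the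
single commutator `⁅u ^ m, v⁆`. Conjugation also costs one commutator. The point is that `C` does
not depend on `m`. -/
theorem exists_list {r : ℕ} {N : ℤ} {w : G} (h : SurfaceRel a r N w) :
    ∃ ys : List G, ys.length = r ∧ ys.prod = w ∧
      ∃ C : ℕ, ∀ m : ℕ, IsCommProd C ((ys.map (· ^ m)).prod * (a ^ ((m : ℤ) * N))⁻¹) := by
  induction h with
  | one => exact ⟨[], rfl, rfl, 0, fun m => by simpa using IsCommProd.one 0⟩
  | zpow k =>
    refine ⟨[a ^ k], rfl, by simp, 0, fun m => ?_⟩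
    have : a ^ ((m : ℤ) * k) = (a ^ k) ^ m := by rw [mul_comm, zpow_mul, zpow_natCast]
    simpa [this] using IsCommProd.one 0
  | comm u v =>
    refine ⟨[u, v * u⁻¹ * v⁻¹], rfl, by simp [commutatorElement_def, mul_assoc], 1, fun m => ?_⟩
    have e : (([u, v * u⁻¹ * v⁻¹].map (· ^ m)).prod * (a ^ ((m : ℤ) * 0))⁻¹) = ⁅u ^ m, v⁆ := by
      simp only [List.map_cons, List.map_nil, List.prod_cons, List.prod_nil, conj_pow, mul_zero,
        zpow_zero, commutatorElement_def, inv_pow]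
      group
    exact e ▸ IsCommProd.comm (u ^ m) v
  | @mul r s M N x y hx hy h1 h2 =>
    obtain ⟨ys, rfl, rfl, C, hC⟩ := h1
    obtain ⟨zs, rfl, rfl, D, hD⟩ := h2
    refine ⟨ys ++ zs, by simp, by simp, D + C, fun m => ?_⟩
    convert! ((hD m).conj (ys.map (· ^ m)).prod).mul (hC m) using 1
    have : a ^ ((m : ℤ) * (M + N)) = a ^ ((m : ℤ) * M) * a ^ ((m : ℤ) * N) := by
      rw [mul_add, zpow_add]
    simp only [this, List.map_append, List.prod_append]
    group
  | @conj r N x t _ h =>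
    obtain ⟨ys, rfl, rfl, C, hC⟩ := h
    have key : ∀ l : List G, (l.map (fun y => t * y * t⁻¹)).prod = t * l.prod * t⁻¹ := by
      intro l
      induction l with
      | nil => simp
      | cons y l ih => simp [ih]
    refine ⟨ys.map (fun y => t * y * t⁻¹), by simp, key ys, C + 1, fun m => ?_⟩
    have e : (ys.map (fun y => t * y * t⁻¹)).map (· ^ m) =
        (ys.map (· ^ m)).map (fun y => t * y * t⁻¹) := by
      simp [Function.comp_def, conj_pow]
    rw [e, key]
    convert! ((hC m).conj t).mul (IsCommProd.comm t (a ^ ((m : ℤ) * N))) using 1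
    simp only [commutatorElement_def]; group

theorem isCommProd_zpow {r : ℕ} {N : ℤ} (h : SurfaceRel a r N 1) :
    ∃ C : ℕ, ∀ k : ℕ, IsCommProd ((r - 2) * k + C) (a ^ (((2 * k + 1 : ℕ) : ℤ) * N)) := by
  obtain ⟨ys, rfl, hys, C, hC⟩ := h.exists_list
  refine ⟨(ys.length - 2) + C, fun k => ?_⟩
  have h1 : IsCommProd ((ys.length - 2) * (k + 1)) (ys.map (· ^ (2 * k + 1))).prod := by
    rcases ys with _ | ⟨y, ys⟩
    · simpa using IsCommProd.one 0
    -- The first letter is the inverse of the product of the others, so only `length - 1` letters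
    -- have to be separated. This saves one more factor and yields `r - 2`.
    · have hy : y = (ys.prod)⁻¹ := eq_inv_of_mul_eq_one_left (by simpa using hys)
      have := ((IsCommProd.list_prod_pow k ys).inv.conj (ys.prod ^ (2 * k + 1))⁻¹)
      have e : ((y :: ys).map (· ^ (2 * k + 1))).prod = (ys.prod ^ (2 * k + 1))⁻¹ *
          (ys.prod ^ (2 * k + 1) * ((ys.map (· ^ (2 * k + 1))).prod)⁻¹)⁻¹ *
          (ys.prod ^ (2 * k + 1))⁻¹⁻¹ := by
        simp [hy, mul_assoc]
      rw [e]
      exact this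
  have e : a ^ (((2 * k + 1 : ℕ) : ℤ) * N) = ((ys.map (· ^ (2 * k + 1))).prod *
      (a ^ (((2 * k + 1 : ℕ) : ℤ) * N))⁻¹)⁻¹ * (ys.map (· ^ (2 * k + 1))).prod := by group
  rw [e]
  refine ((hC _).inv.mul h1).mono (le_of_eq ?_)
  ring

end SurfaceRel

theorem IsCommProd.cl_le {n : ℕ} {g : G} (h : IsCommProd n g) : cl g ≤ n := by
  obtain ⟨L, h1, h2, h3⟩ := h
  exact (iInf₂_le L ⟨h1, h2⟩).trans (by exact_mod_cast h3)

/-- The liminf is at most the one along the exponents `(2 k + 1) |N|`, where `((r - 2) k + C) / ((2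
k + 1) |N|)` bounds the quotient. -/
theorem scl_le_of_surfaceRel {a : G} {r : ℕ} {N : ℤ} (h : SurfaceRel a r N 1) (hN : N ≠ 0) :
    scl a ≤ ENNReal.ofReal (((r - 2 : ℕ) : ℝ) / (2 * |(N : ℝ)|)) := by
  obtain ⟨C, hC⟩ := h.isCommProd_zpow
  set n : ℕ := N.natAbs with hn
  have hn0 : 0 < n := Int.natAbs_pos.2 hN
  have hnR : |(N : ℝ)| = (n : ℝ) := by rw [hn, Nat.cast_natAbs]; simp
  have hcl : ∀ k : ℕ, IsCommProd ((r - 2) * k + C) (a ^ ((2 * k + 1) * n)) := by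
    intro k
    have := hC k
    rcases Int.natAbs_eq N with hN' | hN'
    · rw [hN'] at this
      exact_mod_cast this
    · rw [hN', mul_neg, zpow_neg] at this
      have := this.inv
      rw [inv_inv] at this
      exact_mod_cast this
  have hle : scl a ≤ Filter.liminf (fun k : ℕ =>
      ((cl (a ^ ((2 * k + 1) * n)) : ℕ∞) : ENNReal) / (((2 * k + 1) * n : ℕ) : ENNReal))
      Filter.atTop := by
    have ht : Filter.Tendsto (fun k : ℕ => (2 * k + 1) * n) Filter.atTop Filter.atTop := by
      refine Filter.tendsto_atTop_mono (fun k => ?_) Filter.tendsto_id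
      simp only [id]
      nlinarith
    have := Filter.liminf_le_liminf_of_le ht
      (u := fun n : ℕ => ((cl (a ^ n) : ℕ∞) : ENNReal) / (n : ENNReal))
    rw [scl]
    refine this.trans (le_of_eq ?_)
    rw [← Filter.liminf_comp]
    rfl
  refine hle.trans ?_
  have hlim : Filter.Tendsto (fun k : ℕ => ENNReal.ofReal
      ((((r - 2 : ℕ) : ℝ) * k + C) / ((2 * k + 1) * n))) Filter.atTop
      (nhds (ENNReal.ofReal (((r - 2 : ℕ) : ℝ) / (2 * |(N : ℝ)|)))) := by
    refine ENNReal.tendsto_ofReal ?_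
    rw [hnR]
    have h1 : Filter.Tendsto (fun k : ℕ => ((k : ℝ))⁻¹) Filter.atTop (nhds 0) :=
      tendsto_inv_atTop_nhds_zero_nat
    have h2 : Filter.Tendsto (fun k : ℕ => (((r - 2 : ℕ) : ℝ) + C * (k : ℝ)⁻¹) /
        ((2 + (k : ℝ)⁻¹) * n)) Filter.atTop
        (nhds ((((r - 2 : ℕ) : ℝ) + C * 0) / ((2 + 0) * n))) := by
      refine Filter.Tendsto.div (tendsto_const_nhds.add (h1.const_mul _))
        ((tendsto_const_nhds.add h1).mul_const _) (by positivity)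
    simp only [mul_zero, add_zero] at h2
    refine h2.congr' ?_
    filter_upwards [Filter.eventually_gt_atTop 0] with k hk
    have : (0 : ℝ) < k := by exact_mod_cast hk
    field_simp
  rw [← hlim.liminf_eq]
  refine Filter.liminf_le_liminf (Filter.Eventually.of_forall fun k => ?_)
  have hpos : (0 : ℝ) < (2 * k + 1) * n := by positivity
  rw [ENNReal.ofReal_div_of_pos hpos]
  have e1 : ENNReal.ofReal (((r - 2 : ℕ) : ℝ) * k + C) =
      (((r - 2) * k + C : ℕ) : ENNReal) := by
    rw [← ENNReal.ofReal_natCast]; push_cast; rfl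
  have e2 : ENNReal.ofReal ((2 * k + 1) * n) = (((2 * k + 1) * n : ℕ) : ENNReal) := by
    rw [← ENNReal.ofReal_natCast]; push_cast; rfl
  rw [e1, e2]
  gcongr
  have := ENat.toENNReal_le.2 (hcl k).cl_le
  simpa using this

theorem cl_map_le {H : Type*} [Group H] (e : G →* H) (g : G) : cl (e g) ≤ cl g := by
  refine le_iInf₂ fun L hL => ?_
  have : IsCommProd L.length g := ⟨L, hL.1, hL.2, le_rfl⟩
  exact (this.map e).cl_le

theorem cl_mulEquiv {H : Type*} [Group H] (e : G ≃* H) (g : G) : cl (e g) = cl g := by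
  refine le_antisymm (cl_map_le e.toMonoidHom g) ?_
  simpa using cl_map_le e.symm.toMonoidHom (e g)

theorem scl_mulEquiv {H : Type*} [Group H] (e : G ≃* H) (g : G) : scl (e g) = scl g := by
  simp only [scl, ← map_pow, cl_mulEquiv]

end Algebra

/-! ### Closed walks with their vertices and edges -/

section Walks

variable {V : Type*}

/-- The list `w` of directed edges is a walk from `u` to `v`. -/
def IsWalk : V → List (V × V) → V → Prop
  | u, [], v => u = v
  | u, d :: w, v => u = d.1 ∧ IsWalk d.2 w v

@[simp] theorem isWalk_nil {u v : V} : IsWalk u [] v ↔ u = v := Iff.rfl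

@[simp] theorem isWalk_cons {u v : V} {d : V × V} {w : List (V × V)} :
    IsWalk u (d :: w) v ↔ u = d.1 ∧ IsWalk d.2 w v := Iff.rfl

theorem isWalk_append {u v : V} {w w' : List (V × V)} :
    IsWalk u (w ++ w') v ↔ ∃ x, IsWalk u w x ∧ IsWalk x w' v := by
  induction w generalizing u with
  | nil => simp
  | cons d w ih => simp [ih, and_assoc]

open Classical in
/-- The vertices visited by a walk that starts at `u`. -/
noncomputable def walkVerts (u : V) (w : List (V × V)) : Finset V := insert u (w.map Prod.snd).toFinset

open Classical in
/-- The undirected edges of a list of directed edges. -/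
noncomputable def walkEdges (w : List (V × V)) : Finset (Sym2 V) := (w.map fun d => s(d.1, d.2)).toFinset

theorem mem_walkVerts {u x : V} {w : List (V × V)} :
    x ∈ walkVerts u w ↔ x = u ∨ ∃ d ∈ w, d.2 = x := by
  simp [walkVerts]

theorem self_mem_walkVerts (u : V) (w : List (V × V)) : u ∈ walkVerts u w := by
  simp [walkVerts]

theorem mem_walkEdges {d : V × V} {w : List (V × V)} :
    s(d.1, d.2) ∈ walkEdges w ↔ d ∈ w ∨ d.swap ∈ w := by
  obtain ⟨u, v⟩ := d
  simp only [walkEdges, List.mem_toFinset, List.mem_map, Sym2.eq_iff, Prod.exists, Prod.swap_prod_mk]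
  constructor
  · rintro ⟨x, y, h, ⟨rfl, rfl⟩ | ⟨rfl, rfl⟩⟩ <;> simp [h]
  · rintro (h | h)
    exacts [⟨_, _, h, by simp⟩, ⟨_, _, h, by simp⟩]

theorem IsWalk.end_mem {u v : V} {w : List (V × V)} (h : IsWalk u w v) : v ∈ walkVerts u w := by
  induction w generalizing u with
  | nil => simp_all [walkVerts]
  | cons d w ih =>
    have := ih h.2
    simp only [mem_walkVerts, List.mem_cons] at this ⊢
    aesop

open Classical in
theorem walkVerts_cons (u : V) (d : V × V) (w : List (V × V)) :
    walkVerts u (d :: w) = insert u (walkVerts d.2 w) := by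
  ext x
  simp only [mem_walkVerts, Finset.mem_insert, List.mem_cons]
  aesop

open Classical in
theorem walkVerts_append {u v : V} {w w' : List (V × V)} (h : IsWalk u w v) :
    walkVerts u (w ++ w') = walkVerts u w ∪ walkVerts v w' := by
  have := h.end_mem
  ext x
  simp only [mem_walkVerts, Finset.mem_union, List.mem_append] at this ⊢
  aesop

theorem card_walkVerts_le {v : V} {w : List (V × V)} (h : IsWalk v w v) (hw : w ≠ []) :
    (walkVerts v w).card ≤ w.length := by
  classical
  obtain ⟨w', d, rfl⟩ := List.eq_nil_or_concat w |>.resolve_left hw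
  rw [List.concat_eq_append] at h ⊢
  rw [isWalk_append] at h
  obtain ⟨x, h1, h2⟩ := h
  simp only [isWalk_cons, isWalk_nil] at h2
  have : v ∈ ((w' ++ [d]).map Prod.snd).toFinset := by simp [h2.2]
  rw [walkVerts, Finset.insert_eq_of_mem this]
  exact (List.toFinset_card_le _).trans (by simp)

theorem card_walkEdges_of_unpaired {w : List (V × V)} (hw : w.Nodup)
    (h : ∀ d ∈ w, d.swap ∉ w) : (walkEdges w).card = w.length := by
  classical
  rw [walkEdges, List.toFinset_card_of_nodup, List.length_map]
  refine (List.nodup_map_iff_inj_on hw).2 ?_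
  rintro ⟨a, b⟩ hx ⟨c, d⟩ hy hxy
  rcases Sym2.eq_iff.1 hxy with ⟨h1, h2⟩ | ⟨h1, h2⟩
  · exact Prod.ext h1 h2
  · simp only at h1 h2
    subst h1 h2
    exact absurd hy (h _ hx)

theorem card_walkEdges_append {P w : List (V × V)} (hn : (P ++ w).Nodup)
    (h : ∀ d ∈ P, d.swap ∉ w) :
    (walkEdges (P ++ w)).card = (walkEdges P).card + (walkEdges w).card := by
  classical
  have : walkEdges (P ++ w) = walkEdges P ∪ walkEdges w := by simp [walkEdges]
  rw [this, Finset.card_union_of_disjoint]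
  rw [Finset.disjoint_left]
  intro e he
  simp only [walkEdges, List.mem_toFinset, List.mem_map] at he
  obtain ⟨d, hd, rfl⟩ := he
  rw [mem_walkEdges]
  rintro (h' | h')
  · exact (List.nodup_append'.1 hn).2.2 hd h'
  · exact h d hd h'

theorem walkEdges_perm {w w' : List (V × V)} (h : w.Perm w') : walkEdges w = walkEdges w' := by
  classical
  exact List.toFinset_eq_of_perm _ _ (h.map _)

theorem card_walkEdges_pair {x : V × V} : (walkEdges [x, x.swap]).card = 1 := by
  classical
  have : walkEdges [x, x.swap] = {s(x.1, x.2)} := by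
    simp [walkEdges, Sym2.eq_swap]
  simp [this]

theorem exists_pair_split {w : List (V × V)} {x : V × V} (hne : x.1 ≠ x.2)
    (hx : x ∈ w) (hx' : x.swap ∈ w) :
    ∃ A y B C, w = A ++ y :: (B ++ y.swap :: C) := by
  obtain ⟨s, t, rfl⟩ := List.append_of_mem hx
  have hxx : x.swap ≠ x := fun h => hne (congrArg Prod.snd h)
  simp only [List.mem_append, List.mem_cons, hxx, false_or] at hx'
  rcases hx' with h | h
  · obtain ⟨s₁, s₂, rfl⟩ := List.append_of_mem h
    exact ⟨s₁, x.swap, s₂, t, by simp⟩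
  · obtain ⟨s₁, s₂, rfl⟩ := List.append_of_mem h
    exact ⟨s, x, s₁, s₂, rfl⟩

end Walks

/-! ### Reducing the boundary word of a polygon with glued sides -/

section Polygon

variable {V G : Type*} [Group G]

/-- The sides of a polygon: sides that are glued in pairs carry inverse labels, and the other sides
carry powers of `a`. -/
structure IsPolygon (a : G) (g : V × V → G) (k : V × V → ℤ) (w : List (V × V)) : Prop where
  nodup : w.Nodup
  ne : ∀ d ∈ w, d.1 ≠ d.2
  label : ∀ d ∈ w, (d.swap ∈ w ∧ g d.swap = (g d)⁻¹ ∧ k d = 0) ∨ (d.swap ∉ w ∧ g d = a ^ k d)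

namespace IsPolygon

variable {a : G} {g : V × V → G} {k : V × V → ℤ} {w w' P : List (V × V)}

theorem restrict (h : IsPolygon a g k w) (hw : w.Perm (P ++ w'))
    (hP : ∀ d ∈ P, d.swap ∉ w') : IsPolygon a g k w' where
  nodup := (List.nodup_append'.1 ((hw.nodup_iff).1 h.nodup)).2.1
  ne d hd := h.ne d (hw.mem_iff.2 (List.mem_append_right _ hd))
  label d hd := by
    rcases h.label d (hw.mem_iff.2 (List.mem_append_right _ hd)) with ⟨h1, h2⟩ | ⟨h1, h2⟩
    · refine Or.inl ⟨?_, h2⟩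
      rcases List.mem_append.1 (hw.mem_iff.1 h1) with h3 | h3
      · exact absurd (by simpa using hd) (hP _ h3)
      · exact h3
    · exact Or.inr ⟨fun h3 => h1 (hw.mem_iff.2 (List.mem_append_right _ h3)), h2⟩

theorem prod_eq_zpow (h : ∀ d ∈ w, g d = a ^ k d) : (w.map g).prod = a ^ (w.map k).sum := by
  induction w with
  | nil => simp
  | cons d w ih =>
    simp only [List.map_cons, List.prod_cons, List.sum_cons, zpow_add]
    rw [h d (by simp), ih fun e he => h e (by simp [he])]

/-- A free circle contributes one power of `a`. The empty walk still has one vertex, so there `r =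
0` is forced. -/
theorem surfaceRel_of_unpaired {v : V} (hw : IsWalk v w v) (h : ∀ d ∈ w, g d = a ^ k d) :
    ∃ r, r + (walkVerts v w).card ≤ w.length + 1 ∧
      SurfaceRel a r (w.map k).sum (w.map g).prod := by
  by_cases h0 : w = []
  · subst h0
    exact ⟨0, by simp [walkVerts], by simpa using SurfaceRel.one⟩
  · refine ⟨1, ?_, ?_⟩
    · have := card_walkVerts_le hw h0
      omega
    · rw [prod_eq_zpow h]
      exact SurfaceRel.zpow _

/-- Surgery on an interlaced pair of glued sides. -/
theorem surfaceRel_of_interlaced {v : V} {A B C D E : List (V × V)} {x y : V × V}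
    (hp : IsPolygon a g k (A ++ x :: (B ++ y :: (C ++ x.swap :: (D ++ y.swap :: E)))))
    (hw : IsWalk v (A ++ x :: (B ++ y :: (C ++ x.swap :: (D ++ y.swap :: E)))) v)
    (ih : IsPolygon a g k (A ++ (D ++ (C ++ (B ++ E)))) →
      IsWalk v (A ++ (D ++ (C ++ (B ++ E)))) v →
      ∃ r, r + (walkVerts v (A ++ (D ++ (C ++ (B ++ E))))).card ≤
          (walkEdges (A ++ (D ++ (C ++ (B ++ E))))).card + 1 ∧
        SurfaceRel a r ((A ++ (D ++ (C ++ (B ++ E)))).map k).sum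
          ((A ++ (D ++ (C ++ (B ++ E)))).map g).prod) :
    ∃ r, r + (walkVerts v (A ++ x :: (B ++ y :: (C ++ x.swap :: (D ++ y.swap :: E))))).card ≤
        (walkEdges (A ++ x :: (B ++ y :: (C ++ x.swap :: (D ++ y.swap :: E))))).card + 1 ∧
      SurfaceRel a r ((A ++ x :: (B ++ y :: (C ++ x.swap :: (D ++ y.swap :: E)))).map k).sum
        ((A ++ x :: (B ++ y :: (C ++ x.swap :: (D ++ y.swap :: E)))).map g).prod := by
  classical
  set w := A ++ x :: (B ++ y :: (C ++ x.swap :: (D ++ y.swap :: E))) with hw_def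
  set w' := A ++ (D ++ (C ++ (B ++ E))) with hw'_def
  have perm : w.Perm (([x, x.swap] ++ [y, y.swap]) ++ w') := by
    rw [List.perm_iff_count]
    intro d
    simp only [hw_def, hw'_def, List.count_append, List.count_cons, List.count_nil]
    omega
  have nd : (([x, x.swap] ++ [y, y.swap]) ++ w').Nodup := perm.nodup_iff.1 hp.nodup
  have hx := hp.label x (by simp [hw_def])
  have hx' := hp.label x.swap (by simp [hw_def])
  have hy := hp.label y (by simp [hw_def])
  have hy' := hp.label y.swap (by simp [hw_def])
  have mx : x.swap ∈ w := by simp [hw_def]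
  have my : y.swap ∈ w := by simp [hw_def]
  have mx' : x.swap.swap ∈ w := by simp [hw_def]
  have my' : y.swap.swap ∈ w := by simp [hw_def]
  simp only [mx, mx', my, my', true_and, not_true, false_and, or_false] at hx hx' hy hy'
  have hP : ∀ d ∈ [x, x.swap] ++ [y, y.swap], d.swap ∉ w' := by
    have hdis := (List.nodup_append'.1 nd).2.2
    intro d hd
    refine hdis ?_
    simp only [List.mem_append, List.mem_cons, List.not_mem_nil, or_false] at hd ⊢
    rcases hd with (rfl | rfl) | (rfl | rfl) <;> simp
  have hP2 : ∀ d ∈ [x, x.swap], d.swap ∉ [y, y.swap] := by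
    have hdis := (List.nodup_append'.1 (List.nodup_append'.1 nd).1).2.2
    intro d hd
    refine hdis ?_
    simp only [List.mem_cons, List.not_mem_nil, or_false] at hd ⊢
    rcases hd with rfl | rfl <;> simp
  simp only [hw_def, isWalk_append, isWalk_cons] at hw
  obtain ⟨v1, hA, rfl, v2, hB, rfl, v3, hC, rfl, v4, hD, rfl, hE⟩ := hw
  simp only [Prod.fst_swap, Prod.snd_swap] at hA hB hC hD hE
  have hw' : IsWalk v w' v := by
    simp only [hw'_def, isWalk_append]
    exact ⟨_, hA, _, hD, _, hC, _, hB, hE⟩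
  obtain ⟨r, hr, hrel⟩ := ih (hp.restrict perm hP) hw'
  -- Removing two interlaced pairs deletes two edges and no vertex, which pays for the commutator
  -- counted as `2`.
  have hv : walkVerts v w = walkVerts v w' := by
    rw [hw_def, hw'_def, walkVerts_append hA, walkVerts_append hA, walkVerts_append hD,
      walkVerts_append hC, walkVerts_append hB, walkVerts_cons, walkVerts_append hB,
      walkVerts_cons, walkVerts_append hC, walkVerts_cons, Prod.snd_swap, walkVerts_append hD,
      walkVerts_cons, Prod.snd_swap]
    have h1 := self_mem_walkVerts x.1 D
    have h2 := self_mem_walkVerts y.2 C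
    have h3 := self_mem_walkVerts x.2 B
    have h4 := self_mem_walkVerts y.1 E
    ext z
    simp only [Finset.mem_union, Finset.mem_insert]
    aesop
  have he : (walkEdges w).card = 2 + (walkEdges w').card := by
    rw [walkEdges_perm perm, card_walkEdges_append nd hP,
      card_walkEdges_append (List.nodup_append'.1 nd).1 hP2, card_walkEdges_pair,
      card_walkEdges_pair]
  refine ⟨2 + r, by rw [hv, he]; omega, ?_⟩
  have e1 : (w.map g).prod = ((A.map g).prod * (D.map g).prod * (C.map g).prod) *
      ⁅((A.map g).prod * (D.map g).prod * (C.map g).prod)⁻¹ * ((A.map g).prod * g x),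
        (B.map g).prod * g y * (C.map g).prod⁆ *
      ((A.map g).prod * (D.map g).prod * (C.map g).prod)⁻¹ * (w'.map g).prod := by
    have := handle_eq (A.map g).prod (g x) (B.map g).prod (g y) (C.map g).prod (D.map g).prod
      (E.map g).prod
    rw [← hx.1, ← hy.1] at this
    simp only [hw_def, hw'_def, List.map_append, List.map_cons, List.prod_append, List.prod_cons]
    simpa only [mul_assoc] using this
  have e2 : (w.map k).sum = 0 + (w'.map k).sum := by
    simp only [hw_def, hw'_def, List.map_append, List.map_cons, List.sum_append, List.sum_cons,
      hx.2, hx'.2, hy.2, hy'.2]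
    ring
  rw [e1, e2]
  exact ((SurfaceRel.comm _ _).conj _).mul hrel

/-- Surgery on a pair of glued sides that cuts off a circle of unglued sides. -/
theorem surfaceRel_of_circle {v : V} {A B C : List (V × V)} {x : V × V}
    (hp : IsPolygon a g k (A ++ x :: (B ++ x.swap :: C)))
    (hw : IsWalk v (A ++ x :: (B ++ x.swap :: C)) v)
    (hB : ∀ y ∈ B, y.swap ∉ A ++ x :: (B ++ x.swap :: C))
    (ih : IsPolygon a g k (A ++ C) → IsWalk v (A ++ C) v →
      ∃ r, r + (walkVerts v (A ++ C)).card ≤ (walkEdges (A ++ C)).card + 1 ∧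
        SurfaceRel a r ((A ++ C).map k).sum ((A ++ C).map g).prod) :
    ∃ r, r + (walkVerts v (A ++ x :: (B ++ x.swap :: C))).card ≤
        (walkEdges (A ++ x :: (B ++ x.swap :: C))).card + 1 ∧
      SurfaceRel a r ((A ++ x :: (B ++ x.swap :: C)).map k).sum
        ((A ++ x :: (B ++ x.swap :: C)).map g).prod := by
  classical
  set w := A ++ x :: (B ++ x.swap :: C) with hwd
  set w' := A ++ C with hw'_def
  have perm : w.Perm (([x, x.swap] ++ B) ++ w') := by
    rw [List.perm_iff_count]
    intro d
    simp only [hwd, hw'_def, List.count_append, List.count_cons, List.count_nil]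
    omega
  have nd : (([x, x.swap] ++ B) ++ w').Nodup := perm.nodup_iff.1 hp.nodup
  have hx := hp.label x (by simp [hwd])
  have hx' := hp.label x.swap (by simp [hwd])
  have mx : x.swap ∈ w := by simp [hwd]
  have mx' : x.swap.swap ∈ w := by simp [hwd]
  simp only [mx, mx', true_and, not_true, false_and, or_false] at hx hx'
  have hP : ∀ d ∈ [x, x.swap] ++ B, d.swap ∉ w' := by
    have hdis := (List.nodup_append'.1 nd).2.2
    intro d hd
    simp only [List.mem_append, List.mem_cons, List.not_mem_nil, or_false] at hd
    rcases hd with (rfl | rfl) | hd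
    · exact hdis (by simp)
    · exact hdis (by simp)
    · intro h
      exact hB d hd (perm.mem_iff.2 (List.mem_append_right _ h))
  have hP2 : ∀ d ∈ [x, x.swap], d.swap ∉ B := by
    have hdis := (List.nodup_append'.1 (List.nodup_append'.1 nd).1).2.2
    intro d hd
    refine hdis ?_
    simp only [List.mem_cons, List.not_mem_nil, or_false] at hd ⊢
    rcases hd with rfl | rfl <;> simp
  have hwalk := hw
  simp only [hwd, isWalk_append, isWalk_cons] at hwalk
  obtain ⟨v1, hA, rfl, v2, hBw, rfl, hC⟩ := hwalk
  simp only [Prod.fst_swap, Prod.snd_swap] at hA hBw hC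
  have hw' : IsWalk v w' v := isWalk_append.2 ⟨_, hA, hC⟩
  obtain ⟨r, hr, hrel⟩ := ih (hp.restrict perm hP) hw'
  obtain ⟨s, hs, hsrel⟩ := surfaceRel_of_unpaired (a := a) (g := g) (k := k) hBw (by
    intro d hd
    rcases hp.label d (by simp [hwd, hd]) with h | h
    exacts [absurd h.1 (hB d hd), h.2])
  have hv : walkVerts v w = walkVerts x.2 B ∪ walkVerts v w' := by
    rw [hwd, hw'_def, walkVerts_append hA, walkVerts_append hA, walkVerts_cons,
      walkVerts_append hBw, walkVerts_cons, Prod.snd_swap]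
    have h1 := self_mem_walkVerts x.1 C
    have h3 := self_mem_walkVerts x.2 B
    ext z
    simp only [Finset.mem_union, Finset.mem_insert]
    aesop
  have he : (walkEdges w).card = 1 + B.length + (walkEdges w').card := by
    rw [walkEdges_perm perm, card_walkEdges_append nd hP,
      card_walkEdges_append (List.nodup_append'.1 nd).1 hP2, card_walkEdges_pair,
      card_walkEdges_of_unpaired]
    · exact (List.nodup_append'.1 (List.nodup_append'.1 nd).1).2.1
    · intro d hd h
      exact hB d hd (by simp [hwd, h])
  -- The circle may share vertices with the rest of the walk; this only improves the estimate.
  have hcard : (walkVerts v w).card ≤ (walkVerts x.2 B).card + (walkVerts v w').card := by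
    rw [hv]
    exact Finset.card_union_le _ _
  refine ⟨s + r, by omega, ?_⟩
  have e1 : (w.map g).prod = ((A.map g).prod * g x) * (B.map g).prod *
      ((A.map g).prod * g x)⁻¹ * (w'.map g).prod := by
    simp only [hwd, hw'_def, List.map_append, List.map_cons, List.prod_append, List.prod_cons,
      hx.1]
    group
  have e2 : (w.map k).sum = (B.map k).sum + (w'.map k).sum := by
    simp only [hwd, hw'_def, List.map_append, List.map_cons, List.sum_append, List.sum_cons,
      hx.2, hx'.2]
    ring
  rw [e1, e2]
  exact (hsrel.conj _).mul hrel

/-- A polygon with `V` vertices and `E` edges (after gluing) is a surface of Euler characteristic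
`V - E + 1`. -/
theorem surfaceRel {v : V} (hp : IsPolygon a g k w) (hw : IsWalk v w v) :
    ∃ r, r + (walkVerts v w).card ≤ (walkEdges w).card + 1 ∧
      SurfaceRel a r (w.map k).sum (w.map g).prod := by
  classical
  induction hn : w.length using Nat.strong_induction_on generalizing w with
  | _ n ih =>
  subst hn
  by_cases hpair : ∃ x ∈ w, x.swap ∈ w
  swap
  · push Not at hpair
    rw [card_walkEdges_of_unpaired hp.nodup hpair]
    refine surfaceRel_of_unpaired hw fun d hd => ?_
    rcases hp.label d hd with h | h
    exacts [absurd h.1 (hpair d hd), h.2]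
  obtain ⟨x₀, hx₀, hx₀'⟩ := hpair
  -- An innermost glued pair is chosen. A glued side between its two members then has its partner
  -- outside, so it is interlaced with the pair; if there is no such side, the pair cuts off a free
  -- circle.
  have hex : ∃ n, ∃ A y B C, w = A ++ y :: (B ++ y.swap :: C) ∧ B.length = n := by
    obtain ⟨A, y, B, C, h⟩ := exists_pair_split (hp.ne _ hx₀) hx₀ hx₀'
    exact ⟨_, A, y, B, C, h, rfl⟩
  obtain ⟨A, x, B, C, hwd, hlen⟩ := Nat.find_spec hex
  have hmin : ∀ A y B' C, w = A ++ y :: (B' ++ y.swap :: C) → B.length ≤ B'.length := by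
    intro A y B' C h
    rw [hlen]
    exact Nat.find_min' hex ⟨A, y, B', C, h, rfl⟩
  have hnd := hp.nodup
  by_cases hB : ∃ y ∈ B, y.swap ∈ w
  · obtain ⟨y, hyB, hyw⟩ := hB
    have hyB' : y.swap ∉ B := by
      intro h
      have hne := hp.ne y (by simp [hwd, hyB])
      obtain ⟨A', z, B', C', h'⟩ := exists_pair_split hne hyB h
      have := hmin (A ++ x :: A') z B' (C' ++ x.swap :: C) (by simp [hwd, h'])
      have h2 := congrArg List.length h'
      simp at h2
      omega
    obtain ⟨B₁, B₂, rfl⟩ := List.append_of_mem hyB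
    have hyx : y.swap ≠ x := by
      rintro rfl
      rw [hwd] at hnd
      simp [List.nodup_append', List.nodup_cons] at hnd
    have hyx' : y.swap ≠ x.swap := by
      intro h
      have : y = x := Prod.swap_injective h
      subst this
      rw [hwd] at hnd
      simp [List.nodup_append', List.nodup_cons] at hnd
    have hyw' : y.swap ∈ A ∨ y.swap ∈ C := by
      rw [hwd] at hyw
      simp only [List.mem_append, List.mem_cons] at hyw hyB'
      tauto
    rcases hyw' with h | h
    · obtain ⟨A₁, A₂, rfl⟩ := List.append_of_mem h
      have e : w = A₁ ++ y.swap :: (A₂ ++ x :: (B₁ ++ y.swap.swap :: (B₂ ++ x.swap :: C))) := by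
        simp [hwd]
      subst e
      refine surfaceRel_of_interlaced hp hw fun h1 h2 => ih _ ?_ h1 h2 rfl
      simp; omega
    · obtain ⟨C₁, C₂, rfl⟩ := List.append_of_mem h
      have e : w = A ++ x :: (B₁ ++ y :: (B₂ ++ x.swap :: (C₁ ++ y.swap :: C₂))) := by
        simp [hwd]
      subst e
      refine surfaceRel_of_interlaced hp hw fun h1 h2 => ih _ ?_ h1 h2 rfl
      simp; omega
  · push Not at hB
    subst hwd
    refine surfaceRel_of_circle hp hw hB fun h1 h2 => ih _ ?_ h1 h2 rfl
    simp; omega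

end IsPolygon

end Polygon

/-! ### Unfolding a triangulated surface into a polygon -/

namespace OrientedSurface

theorem set_rotate {V : Type*} (u v w : V) : ({u, v, w} : Set V) = {v, w, u} := by
  ext x; simp only [Set.mem_insert_iff, Set.mem_singleton_iff]; tauto

variable {V : Type*} [Fintype V] (K : OrientedSurface V)

/-- `d` is a positively directed side of a triangle in `D`. -/
def DartIn (D : Set (Set V)) (d : V × V) : Prop :=
  ∃ z, K.tri d.1 d.2 z ∧ ({d.1, d.2, z} : Set V) ∈ D

variable {K}

theorem tri_ne {u v w : V} (h : K.tri u v w) : u ≠ v ∧ v ≠ w ∧ w ≠ u :=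
  ⟨K.ne h, K.ne (K.rotate h), K.ne (K.rotate (K.rotate h))⟩

/-- Triangles are counted as vertex sets. The set determines the cyclic order because `not_flip`
excludes the opposite orientation. -/
theorem mem_sides_of_set_eq {a b c d e f : V} (h : K.tri a b c) (h' : K.tri d e f)
    (hs : ({d, e, f} : Set V) = {a, b, c}) :
    (d = a ∧ e = b) ∨ (d = b ∧ e = c) ∨ (d = c ∧ e = a) := by
  have hd : d ∈ ({a, b, c} : Set V) := hs ▸ (by simp)
  have he : e ∈ ({a, b, c} : Set V) := hs ▸ (by simp)
  have hf : f ∈ ({a, b, c} : Set V) := hs ▸ (by simp)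
  obtain ⟨n1, n2, n3⟩ := tri_ne h'
  have h1 := K.not_flip h
  have h2 := K.not_flip (K.rotate h)
  have h3 := K.not_flip (K.rotate (K.rotate h))
  simp only [Set.mem_insert_iff, Set.mem_singleton_iff] at hd he hf
  rcases hd with rfl | rfl | rfl <;> rcases he with rfl | rfl | rfl <;>
    rcases hf with rfl | rfl | rfl <;> simp_all

theorem DartIn.mem {D : Set (Set V)} {u v w : V} (h : K.DartIn D (u, v)) (ht : K.tri u v w) :
    ({u, v, w} : Set V) ∈ D := by
  obtain ⟨z, hz, hD⟩ := h
  rwa [K.coherent ht hz]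

theorem DartIn.rotate {D : Set (Set V)} {u v w : V} (h : K.DartIn D (u, v)) (ht : K.tri u v w) :
    K.DartIn D (v, w) :=
  ⟨u, K.rotate ht, by simpa only [← set_rotate] using h.mem ht⟩

/-- A set of triangles that is closed under adjacency contains all triangles. -/
theorem eq_triangles_of_closed {D : Set (Set V)} (hD : D ⊆ K.triangles) (hne : D.Nonempty)
    (hcl : ∀ u v z, K.DartIn D (u, v) → K.tri v u z → K.DartIn D (v, u)) : D = K.triangles := by
  have star : ∀ v u u', (∃ w, K.tri v u w ∨ K.tri v w u) → (∃ w, K.tri v u' w ∨ K.tri v w u') →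
      (K.DartIn D (v, u) ∨ K.DartIn D (u, v)) → (K.DartIn D (v, u') ∨ K.DartIn D (u', v)) := by
    intro v u u' hu hu'
    have key : ∀ x y, K.tri v x y → ((K.DartIn D (v, x) ∨ K.DartIn D (x, v)) ↔
        (K.DartIn D (v, y) ∨ K.DartIn D (y, v))) := by
      intro x y hxy
      constructor
      · intro h
        have h1 : K.DartIn D (v, x) := h.elim id fun h => hcl _ _ y h hxy
        exact Or.inr ((h1.rotate hxy).rotate (K.rotate hxy))
      · intro h
        have h1 : K.DartIn D (y, v) := h.elim (fun h => hcl _ _ x h (K.rotate (K.rotate hxy))) id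
        exact Or.inl (h1.rotate (K.rotate (K.rotate hxy)))
    have := K.link_connected v u u' hu hu'
    have h2 : (K.DartIn D (v, u) ∨ K.DartIn D (u, v)) ↔
        (K.DartIn D (v, u') ∨ K.DartIn D (u', v)) := by
      induction this with
      | rel x y h => exact key x y h
      | refl => rfl
      | symm x y h ih => exact (ih hu' hu).symm
      | trans x y z h1 h2 ih1 ih2 =>
        -- `EqvGen` could pass through a vertex outside the link, but such a vertex is equivalent
        -- only to itself.
        have hy : ∃ w, K.tri v y w ∨ K.tri v w y := by
          by_contra hcon
          push Not at hcon
          have : ∀ p q, Relation.EqvGen (K.tri v) p q → (p = y ↔ q = y) := by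
            intro p q hpq
            induction hpq with
            | rel p q h =>
              constructor
              · rintro rfl; exact absurd h (hcon _).1
              · rintro rfl; exact absurd h (hcon _).2
            | refl => rfl
            | symm _ _ _ ih => exact ih.symm
            | trans _ _ _ _ _ ih1 ih2 => exact ih1.trans ih2
          have := (this x y h1).2 rfl
          subst this
          obtain ⟨w, hw⟩ := hu
          exact hw.elim (hcon w).1 (hcon w).2
        exact (ih1 hu hy).trans (ih2 hy hu')
    exact h2.1
  have star' : ∀ v u w, K.tri v u w → (∃ x, K.DartIn D (v, x)) → K.DartIn D (v, u) := by
    rintro v u w h ⟨x, y, hx, hxD⟩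
    rcases star v x u ⟨y, Or.inl hx⟩ ⟨w, Or.inl h⟩ (Or.inl ⟨y, hx, hxD⟩) with h1 | h1
    exacts [h1, hcl _ _ _ h1 h]
  have conn : ∀ u v, (∃ x, K.DartIn D (u, x)) ↔ (∃ x, K.DartIn D (v, x)) := by
    intro u v
    induction K.connected u v with
    | rel x y h =>
      obtain ⟨z, hz⟩ := h
      constructor
      · intro h; exact ⟨z, (star' x y z hz h).rotate hz⟩
      · intro h
        have h1 := star' y z x (K.rotate hz) h
        exact ⟨y, (h1.rotate (K.rotate hz)).rotate (K.rotate (K.rotate hz))⟩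
    | refl => rfl
    | symm _ _ _ ih => exact ih.symm
    | trans _ _ _ _ _ ih1 ih2 => exact ih1.trans ih2
  refine hD.antisymm ?_
  rintro s ⟨u, v, w, h, rfl⟩
  obtain ⟨s₀, hs₀⟩ := hne
  obtain ⟨u₀, v₀, w₀, h₀, rfl⟩ := hD hs₀
  exact (star' u v w h ((conn u₀ u).1 ⟨v₀, w₀, h₀, hs₀⟩)).mem h

variable {G : Type*} [Group G]

/-- The closed walk `w` is the boundary of a polygon that is obtained from the triangles in `D` by
gluing them along the edges in `R`. -/
structure IsGluing (K : OrientedSurface V) (g : V × V → G) (v₀ : V) (D : Set (Set V))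
    (R : Finset (Sym2 V)) (w : List (V × V)) : Prop where
  subset : D ⊆ K.triangles
  walk : IsWalk v₀ w v₀
  nodup : w.Nodup
  mem : ∀ d ∈ w, K.DartIn D d
  -- A side missing from the walk has been glued, so both of its directions are interior to the
  -- polygon.
  out : ∀ d, K.DartIn D d → d ∉ w → K.DartIn D d.swap ∧ d.swap ∉ w
  glued_mem : ∀ d : V × V, s(d.1, d.2) ∈ R → K.DartIn D d
  glued_notMem : ∀ d ∈ w, s(d.1, d.2) ∉ R
  -- The glued edges form a tree dual to the triangles.
  card : R.card + 1 = D.ncard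
  verts : ∀ d, K.DartIn D d → d.1 ∈ walkVerts v₀ w
  prod : (w.map g).prod = 1

theorem isGluing_single {g : V × V → G}
    (hg : ∀ u v w, K.tri u v w → g (u, v) * g (v, w) * g (w, u) = 1) {u v w : V}
    (h : K.tri u v w) : K.IsGluing g u {{u, v, w}} ∅ [(u, v), (v, w), (w, u)] := by
  obtain ⟨n1, n2, n3⟩ := tri_ne h
  have key : ∀ d, K.DartIn {{u, v, w}} d → d ∈ [(u, v), (v, w), (w, u)] := by
    rintro ⟨x, y⟩ ⟨z, hz, hD⟩
    rcases mem_sides_of_set_eq h hz hD with ⟨rfl, rfl⟩ | ⟨rfl, rfl⟩ | ⟨rfl, rfl⟩ <;> simp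
  refine ⟨?_, by simp, ?_, ?_, fun d hd hdw => absurd (key d hd) hdw, by simp, by simp, by simp,
    ?_, ?_⟩
  · rintro s rfl
    exact ⟨u, v, w, h, rfl⟩
  · simp [n1, n2, n3.symm, n3, n1.symm]
  · have h0 : K.DartIn {{u, v, w}} (u, v) := ⟨w, h, rfl⟩
    intro d hd
    simp only [List.mem_cons, List.not_mem_nil, or_false] at hd
    rcases hd with rfl | rfl | rfl
    exacts [h0, h0.rotate h, (h0.rotate h).rotate (K.rotate h)]
  · intro d hd
    have := key d hd
    simp only [List.mem_cons, List.not_mem_nil, or_false] at this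
    rcases this with rfl | rfl | rfl <;> simp [mem_walkVerts]
  · simpa [mul_assoc] using hg u v w h

/-- A new triangle `v u z` is attached along a boundary side `(u, v)`: this letter is replaced by
`(u, z), (z, v)`, and the cocycle condition keeps the product of labels. Even if the new sides are
also adjacent to old triangles, they stay unglued. -/
theorem IsGluing.extend {g : V × V → G}
    (hg : ∀ u v w, K.tri u v w → g (u, v) * g (v, w) * g (w, u) = 1)
    (hinv : ∀ u v w, K.tri u v w → g (v, u) = (g (u, v))⁻¹) {v₀ : V} {D : Set (Set V)}
    {R : Finset (Sym2 V)} {l : List (V × V)} (h : K.IsGluing g v₀ D R l)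
    (hD : D ≠ K.triangles) :
    ∃ D' R' l', K.IsGluing g v₀ D' R' l' ∧ D'.ncard = D.ncard + 1 := by
  classical
  have hne : D.Nonempty := by
    apply Set.nonempty_of_ncard_ne_zero
    have := h.card
    omega
  have hex : ∃ u v z, K.DartIn D (u, v) ∧ K.tri v u z ∧ ¬ K.DartIn D (v, u) := by
    by_contra hcon
    push Not at hcon
    exact hD (eq_triangles_of_closed h.subset hne hcon)
  obtain ⟨u, v, z, huv, ht, hvu⟩ := hex
  obtain ⟨n1, n2, n3⟩ := tri_ne ht
  have huvl : (u, v) ∈ l := by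
    by_contra hcon
    exact hvu (h.out _ huv hcon).1
  have hT : ({v, u, z} : Set V) ∉ D := fun hcon => hvu ⟨z, ht, hcon⟩
  have huz : ¬ K.DartIn D (u, z) := fun hcon =>
    hvu ((hcon.rotate (K.rotate ht)).rotate (K.rotate (K.rotate ht)))
  have hzv : ¬ K.DartIn D (z, v) := fun hcon => hvu (hcon.rotate (K.rotate (K.rotate ht)))
  have dart' : ∀ d, K.DartIn (insert {v, u, z} D) d →
      K.DartIn D d ∨ d = (v, u) ∨ d = (u, z) ∨ d = (z, v) := by
    rintro ⟨x, y⟩ ⟨t, hxy, hm⟩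
    rcases hm with hm | hm
    · right
      rcases mem_sides_of_set_eq ht hxy hm with ⟨rfl, rfl⟩ | ⟨rfl, rfl⟩ | ⟨rfl, rfl⟩ <;> simp
    · exact Or.inl ⟨t, hxy, hm⟩
  have mono : ∀ d, K.DartIn D d → K.DartIn (insert {v, u, z} D) d := by
    rintro d ⟨t, h1, h2⟩
    exact ⟨t, h1, Or.inr h2⟩
  have dvu : K.DartIn (insert {v, u, z} D) (v, u) := ⟨z, ht, Or.inl rfl⟩
  have duz := dvu.rotate ht
  have dzv := duz.rotate (K.rotate ht)
  have hvul : (v, u) ∉ l := fun hc => hvu (h.mem _ hc)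
  have huzl : (u, z) ∉ l := fun hc => huz (h.mem _ hc)
  have hzvl : (z, v) ∉ l := fun hc => hzv (h.mem _ hc)
  obtain ⟨A, B, rfl⟩ := List.append_of_mem huvl
  have hnd := h.nodup
  have huvAB : (u, v) ∉ A ∧ (u, v) ∉ B := by
    simp only [List.nodup_append', List.nodup_cons, List.disjoint_cons_right] at hnd
    exact ⟨hnd.2.2.1, hnd.2.1.1⟩
  have huv' : (u, v) ∉ A ++ (u, z) :: (z, v) :: B := by
    simp [huvAB, n2, n3.symm]
  have hvu' : (v, u) ∉ A ++ (u, z) :: (z, v) :: B := by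
    simp only [List.mem_append, List.mem_cons, not_or] at hvul
    simp [hvul, n1, n1.symm]
  have sub' : ∀ d ∈ A ++ (u, v) :: B, d ≠ (u, v) → d ∈ A ++ (u, z) :: (z, v) :: B := by
    intro d hd hne
    simp only [List.mem_append, List.mem_cons] at hd ⊢
    tauto
  have mem' : ∀ d ∈ A ++ (u, z) :: (z, v) :: B,
      (d ∈ A ++ (u, v) :: B) ∨ d = (u, z) ∨ d = (z, v) := by
    intro d hd
    simp only [List.mem_append, List.mem_cons] at hd ⊢
    tauto
  have hw := h.walk
  simp only [isWalk_append, isWalk_cons] at hw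
  obtain ⟨x, hA, rfl, hB⟩ := hw
  have verts' : walkVerts v₀ (A ++ (x, v) :: B) ⊆ walkVerts v₀ (A ++ (x, z) :: (z, v) :: B) := by
    intro y hy
    simp only [mem_walkVerts, List.mem_append, List.mem_cons] at hy ⊢
    rcases hy with rfl | ⟨d, hd, rfl⟩
    · exact Or.inl rfl
    · right
      rcases hd with hd | rfl | hd
      exacts [⟨d, by simp [hd]⟩, ⟨(z, v), by simp⟩, ⟨d, by simp [hd]⟩]
  have hR : s(x, v) ∉ R := h.glued_notMem (x, v) huvl
  refine ⟨insert {v, x, z} D, insert s(x, v) R, A ++ (x, z) :: (z, v) :: B,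
    ⟨?_, ?_, ?_, ?_, ?_, ?_, ?_, ?_, ?_, ?_⟩, Set.ncard_insert_of_notMem hT (Set.toFinite D)⟩
  · exact Set.insert_subset ⟨v, x, z, ht, rfl⟩ h.subset
  · simp only [isWalk_append, isWalk_cons]
    exact ⟨x, hA, rfl, trivial, hB⟩
  · simp only [List.nodup_append', List.nodup_cons, List.disjoint_cons_right, List.mem_append,
      List.mem_cons, not_or] at hnd huzl hzvl ⊢
    refine ⟨hnd.1, ⟨⟨?_, huzl.2.2⟩, hzvl.2.2, hnd.2.1.2⟩, huzl.1, hzvl.1, hnd.2.2.2⟩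
    simp [n2]
  · intro d hd
    rcases mem' d hd with hd | rfl | rfl
    exacts [mono _ (h.mem d hd), duz, dzv]
  · intro d hd hdw
    rcases dart' d hd with hd | rfl | rfl | rfl
    · by_cases hdl : d ∈ A ++ (x, v) :: B
      · have : d = (x, v) := by
          by_contra hcon
          exact hdw (sub' d hdl hcon)
        subst this
        exact ⟨dvu, hvu'⟩
      · obtain ⟨h1, h2⟩ := h.out d hd hdl
        refine ⟨mono _ h1, fun hc => ?_⟩
        rcases mem' _ hc with hc | hc | hc
        · exact h2 hc
        · exact huz (hc ▸ h1)
        · exact hzv (hc ▸ h1)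
    · exact ⟨mono _ huv, huv'⟩
    · exact absurd (by simp) hdw
    · exact absurd (by simp) hdw
  · intro d hd
    rcases Finset.mem_insert.1 hd with hd | hd
    · obtain ⟨d1, d2⟩ := d
      rcases Sym2.eq_iff.1 hd with ⟨rfl, rfl⟩ | ⟨rfl, rfl⟩
      exacts [mono _ huv, dvu]
    · exact mono _ (h.glued_mem d hd)
  · intro d hd hc
    rcases Finset.mem_insert.1 hc with hc | hc
    · obtain ⟨d1, d2⟩ := d
      rcases Sym2.eq_iff.1 hc with ⟨rfl, rfl⟩ | ⟨rfl, rfl⟩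
      exacts [huv' hd, hvu' hd]
    · have h1 := h.glued_mem d hc
      rcases mem' d hd with hd | rfl | rfl
      exacts [h.glued_notMem d hd hc, huz h1, hzv h1]
  · rw [Finset.card_insert_of_notMem hR, Set.ncard_insert_of_notMem hT (Set.toFinite D), h.card]
  · intro d hd
    rcases dart' d hd with hd | rfl | rfl | rfl
    · exact verts' (h.verts d hd)
    · exact mem_walkVerts.2 (Or.inr ⟨(z, v), by simp, rfl⟩)
    · exact verts' (h.verts (x, v) huv)
    · exact mem_walkVerts.2 (Or.inr ⟨(x, z), by simp, rfl⟩)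
  · have h1 := h.prod
    have h2 : g (x, v) = g (x, z) * g (z, v) := by
      have h3 := hg v x z ht
      rw [hinv v x z ht, mul_assoc] at *
      exact (eq_inv_of_mul_eq_one_right h3).symm
    simpa [h2, mul_assoc] using h1

theorem exists_isGluing [Nonempty V] {g : V × V → G}
    (hg : ∀ u v w, K.tri u v w → g (u, v) * g (v, w) * g (w, u) = 1)
    (hinv : ∀ u v w, K.tri u v w → g (v, u) = (g (u, v))⁻¹) :
    ∃ v₀ R l, K.IsGluing g v₀ K.triangles R l := by
  obtain ⟨v₀⟩ := ‹Nonempty V›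
  obtain ⟨u, w, h⟩ := K.pure v₀
  have key : ∀ n < K.triangles.ncard, ∃ D R l, K.IsGluing g v₀ D R l ∧ D.ncard = n + 1 := by
    intro n
    induction n with
    | zero => exact fun _ => ⟨_, _, _, isGluing_single hg h, by simp⟩
    | succ n ih =>
      intro hn
      obtain ⟨D, R, l, h1, h2⟩ := ih (by omega)
      obtain ⟨D', R', l', h3, h4⟩ := h1.extend hg hinv (by rintro rfl; omega)
      exact ⟨D', R', l', h3, by omega⟩
  have hpos : 0 < K.triangles.ncard :=
    (Set.ncard_pos (Set.toFinite _)).2 ⟨_, v₀, u, w, h, rfl⟩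
  obtain ⟨D, R, l, h1, h2⟩ := key (K.triangles.ncard - 1) (by omega)
  have : D = K.triangles := Set.eq_of_subset_of_ncard_le h1.subset (by omega) (Set.toFinite _)
  subst this
  exact ⟨v₀, R, l, h1⟩

/-- A cocycle on an oriented surface whose values on the boundary edges are powers of `a` gives a
relation of the complexity that is prescribed by the Euler characteristic. -/
theorem exists_surfaceRel [Nonempty V] {a : G} {g : V × V → G} {k : V × V → ℤ}
    (hg : ∀ u v w, K.tri u v w → g (u, v) * g (v, w) * g (w, u) = 1)
    (hinv : ∀ u v w, K.tri u v w → g (v, u) = (g (u, v))⁻¹)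
    (hk : ∀ e : K.BoundaryEdge, g e.1 = a ^ k e.1) :
    ∃ r : ℕ, (r : ℤ) ≤ 2 - K.eulerChar ∧ SurfaceRel a r (∑ e : K.BoundaryEdge, k e.1) 1 := by
  classical
  obtain ⟨v₀, R, l, h⟩ := K.exists_isGluing hg hinv
  have dart : ∀ u v w, K.tri u v w → K.DartIn K.triangles (u, v) :=
    fun u v w h => ⟨w, h, u, v, w, h, rfl⟩
  let k' : V × V → ℤ := fun d => if K.IsBoundaryEdge d.1 d.2 then k d else 0
  have hpoly : IsPolygon a g k' l := by
    refine ⟨h.nodup, fun d hd => ?_, fun d hd => ?_⟩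
    · obtain ⟨z, hz, -⟩ := h.mem d hd
      exact K.ne hz
    · obtain ⟨z, hz, -⟩ := h.mem d hd
      by_cases hs : d.swap ∈ l
      · left
        obtain ⟨z', hz', -⟩ := h.mem _ hs
        refine ⟨hs, hinv _ _ _ hz, if_neg fun hb => hb.2 ⟨z', hz'⟩⟩
      · right
        have hb : K.IsBoundaryEdge d.1 d.2 := by
          refine ⟨⟨z, hz⟩, ?_⟩
          rintro ⟨z', hz'⟩
          exact (h.out d.swap (dart _ _ _ hz') hs).2 (by simpa using hd)
        refine ⟨hs, ?_⟩
        simp only [k', if_pos hb]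
        exact hk ⟨d, hb⟩
  obtain ⟨r, hr, hrel⟩ := hpoly.surfaceRel h.walk
  have hsum : (l.map k').sum = ∑ e : K.BoundaryEdge, k e.1 := by
    have h1 : (l.map k').sum = ∑ d ∈ l.toFinset, k' d := (List.sum_toFinset k' h.nodup).symm
    have h2 : ∑ d ∈ l.toFinset, k' d =
        ∑ d ∈ l.toFinset.filter (fun d => K.IsBoundaryEdge d.1 d.2), k d :=
      (Finset.sum_filter _ _).symm
    rw [h1, h2]
    refine (Finset.sum_bij (fun (e : K.BoundaryEdge) _ => e.1) ?_ ?_ ?_ ?_).symm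
    · rintro ⟨d, hb⟩ -
      simp only [Finset.mem_filter, List.mem_toFinset]
      refine ⟨?_, hb⟩
      by_contra hc
      obtain ⟨z, hz⟩ := hb.1
      obtain ⟨⟨z', hz', -⟩, -⟩ := h.out d (dart _ _ _ hz) hc
      exact hb.2 ⟨z', hz'⟩
    · rintro ⟨d, hb⟩ - ⟨d', hb'⟩ - rfl
      rfl
    · intro d hd
      exact ⟨⟨d, (Finset.mem_filter.1 hd).2⟩, Finset.mem_univ _, rfl⟩
    · intros; rfl
  rw [hsum, h.prod] at hrel
  refine ⟨r, ?_, hrel⟩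
  have hV : walkVerts v₀ l = Finset.univ := by
    ext v
    obtain ⟨u, w, hv⟩ := K.pure v
    simpa using h.verts _ (dart _ _ _ hv)
  -- The edges are either glued inside the polygon or lie on its boundary. With `R.card + 1`
  -- triangles the count becomes `V - E + 1` for the polygon; only this inequality is needed.
  have hE : (walkEdges l).card + R.card ≤ K.edges.ncard := by
    have hdis : Disjoint (walkEdges l) R := by
      rw [Finset.disjoint_left]
      intro e he
      simp only [walkEdges, List.mem_toFinset, List.mem_map] at he
      obtain ⟨d, hd, rfl⟩ := he
      exact h.glued_notMem d hd
    rw [← Finset.card_union_of_disjoint hdis, ← Set.ncard_coe_finset]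
    refine Set.ncard_le_ncard_of_injOn (fun e : Sym2 V => {x | x ∈ e}) ?_ ?_ (Set.toFinite _)
    · have key : ∀ d, K.DartIn K.triangles d → {x | x ∈ s(d.1, d.2)} ∈ K.edges := by
        rintro ⟨u, v⟩ ⟨z, hz, -⟩
        refine ⟨u, v, z, hz, ?_⟩
        ext x; simp
      intro e he
      rcases Finset.mem_union.1 (Finset.mem_coe.1 he) with he | he
      · simp only [walkEdges, List.mem_toFinset, List.mem_map] at he
        obtain ⟨d, hd, rfl⟩ := he
        exact key d (h.mem d hd)
      · induction e with
        | _ u v => exact key (u, v) (h.glued_mem (u, v) he)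
    · intro e _ e' _ hee
      exact Sym2.ext fun x => by simpa using Set.ext_iff.1 hee x
  have := h.card
  rw [hV, Finset.card_univ] at hr
  rw [eulerChar]
  omega

end OrientedSurface

/-! ### Turns of paths and degrees of maps from the torus -/

theorem eq_of_continuous_of_int {X : Type*} [TopologicalSpace X] [PreconnectedSpace X] {f : X → ℝ}
    (hf : Continuous f) (hint : ∀ x, ∃ n : ℤ, f x = n) (x y : X) : f x = f y := by
  choose g hg using hint
  have : Continuous g := by
    rw [Int.isClosedEmbedding_coe_real.isInducing.continuous_iff]
    exact hf.congr hg
  rw [hg, hg, PreconnectedSpace.constant ‹_› this]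

theorem exp_two_pi_eq_iff {s t : ℝ} :
    Circle.exp (2 * Real.pi * s) = Circle.exp (2 * Real.pi * t) ↔ ∃ n : ℤ, s - t = n := by
  rw [Circle.exp_eq_exp]
  refine exists_congr fun n => ?_
  have := Real.pi_ne_zero
  constructor
  · intro h
    have h2 : 2 * Real.pi * (s - t - n) = 0 := by linarith
    have := (mul_eq_zero.1 h2).resolve_left (by positivity)
    linarith
  · intro h
    rw [show s = t + n by linarith]
    ring

theorem turns_eq {c : C(I, Circle)} {θ : C(I, ℝ)}
    (h : ∀ t, Circle.exp (2 * Real.pi * θ t) = c t) : turns c = θ 1 - θ 0 := by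
  have h' := (exists_circle_lift c).choose_spec
  have := eq_of_continuous_of_int (f := fun t => (exists_circle_lift c).choose t - θ t)
    (by fun_prop) (fun t => exp_two_pi_eq_iff.1 ((h' t).trans (h t).symm)) 1 0
  rw [turns]
  linarith

theorem turns_circleLoop : turns circleLoop = 1 := by
  have := turns_eq (c := circleLoop) (θ := ⟨fun t => (t : ℝ), by fun_prop⟩) fun t => rfl
  simpa using this

theorem turns_const (c : C(I, Circle)) (z : Circle) (hc : ∀ t, c t = z) : turns c = 0 := by
  obtain ⟨θ, hθ⟩ := exists_circle_lift c
  have h := turns_eq (c := c) (θ := ⟨fun _ => θ 0, by fun_prop⟩) (by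
    intro t; rw [hc t, ← hc 0]; exact hθ 0)
  simpa using h

theorem exists_plane_lift {F : ℝ × ℝ → Circle} (hF : Continuous F) :
    ∃ Θ : ℝ × ℝ → ℝ, Continuous Θ ∧ ∀ x, Circle.exp (2 * Real.pi * Θ x) = F x := by
  have hT : (2 * Real.pi) ≠ 0 := by positivity
  let e := AddCircle.homeomorphCircle hT
  obtain ⟨x, hx⟩ := QuotientAddGroup.mk_surjective (e.symm (F 0))
  obtain ⟨Γ, ⟨-, hΓ⟩, -⟩ := (AddCircle.isCoveringMap_coe (2 * Real.pi)).existsUnique_continuousMap_lifts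
    ((e.symm : C(Circle, AddCircle (2 * Real.pi))).comp ⟨F, hF⟩) (0 : ℝ × ℝ) x hx
  refine ⟨fun t => Γ t / (2 * Real.pi), by fun_prop, fun t => ?_⟩
  have h : ((Γ t : ℝ) : AddCircle (2 * Real.pi)) = e.symm (F t) := congrFun hΓ t
  have h2 : e (Γ t : AddCircle (2 * Real.pi)) = F t := by rw [h]; simp
  rw [← h2]
  simp only [mul_div_cancel₀ _ hT]
  simp [e, AddCircle.homeomorphCircle_apply, AddCircle.toCircle_apply_mk]

theorem exp_two_pi_surjective (z : Circle) : ∃ s : ℝ, Circle.exp (2 * Real.pi * s) = z := by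
  obtain ⟨θ, hθ⟩ := exists_circle_lift (ContinuousMap.const I z)
  exact ⟨θ 0, hθ 0⟩

/-- The action on first homology of a map from the torus to the circle. -/
theorem exists_degrees {F : Circle × Circle → Circle} (hF : Continuous F) :
    ∃ (A B : ℤ) (η : Circle × Circle → ℝ), ∀ c d : C(I, Circle),
      turns ⟨fun t => F (c t, d t), by fun_prop⟩ =
        A * turns c + B * turns d + (η (c 1, d 1) - η (c 0, d 0)) := by
  obtain ⟨Θ, hΘ, hlift⟩ := exists_plane_lift (F := fun x : ℝ × ℝ =>
    F (Circle.exp (2 * Real.pi * x.1), Circle.exp (2 * Real.pi * x.2))) (by fun_prop)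
  have hone : ∀ s : ℝ, Circle.exp (2 * Real.pi * (s + 1)) = Circle.exp (2 * Real.pi * s) :=
    fun s => exp_two_pi_eq_iff.2 ⟨1, by simp⟩
  have h1 : ∀ x : ℝ × ℝ, ∃ n : ℤ, Θ (x.1 + 1, x.2) - Θ x = n := by
    intro x
    refine exp_two_pi_eq_iff.1 ?_
    rw [hlift, hlift]
    simp only [hone]
  have h2 : ∀ x : ℝ × ℝ, ∃ n : ℤ, Θ (x.1, x.2 + 1) - Θ x = n := by
    intro x
    refine exp_two_pi_eq_iff.1 ?_
    rw [hlift, hlift]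
    simp only [hone]
  obtain ⟨A, hA⟩ := h1 0
  obtain ⟨B, hB⟩ := h2 0
  have hA' : ∀ s t, Θ (s + 1, t) = Θ (s, t) + A := by
    intro s t
    have := eq_of_continuous_of_int (f := fun x : ℝ × ℝ => Θ (x.1 + 1, x.2) - Θ x) (by fun_prop)
      h1 (s, t) 0
    simp only at this hA
    linarith
  have hB' : ∀ s t, Θ (s, t + 1) = Θ (s, t) + B := by
    intro s t
    have := eq_of_continuous_of_int (f := fun x : ℝ × ℝ => Θ (x.1, x.2 + 1) - Θ x) (by fun_prop)
      h2 (s, t) 0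
    simp only at this hB
    linarith
  -- Without its linear part the lift is doubly periodic and descends to `η` on the torus.
  -- Continuity of `η` is not needed: only its end values enter, and they telescope along the
  -- boundary.
  let P : ℝ → ℝ → ℝ := fun s t => Θ (s, t) - A * s - B * t
  have hP1 : ∀ (n : ℤ) (s t : ℝ), P (s + n) t = P s t := by
    intro n s t
    have hper : Function.Periodic (fun s => P s t) 1 := by
      intro s; simp only [P, hA']; ring
    simpa using hper.int_mul n s
  have hP2 : ∀ (n : ℤ) (s t : ℝ), P s (t + n) = P s t := by
    intro n s t
    have hper : Function.Periodic (fun t => P s t) 1 := by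
      intro s; simp only [P, hB']; ring
    simpa using hper.int_mul n t
  choose ℓ hℓ using exp_two_pi_surjective
  have hη : ∀ s t : ℝ, P (ℓ (Circle.exp (2 * Real.pi * s))) (ℓ (Circle.exp (2 * Real.pi * t))) =
      P s t := by
    intro s t
    obtain ⟨m, hm⟩ := exp_two_pi_eq_iff.1 (hℓ (Circle.exp (2 * Real.pi * s)))
    obtain ⟨n, hn⟩ := exp_two_pi_eq_iff.1 (hℓ (Circle.exp (2 * Real.pi * t)))
    rw [sub_eq_iff_eq_add'] at hm hn
    rw [hm, hn, hP1, hP2]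
  refine ⟨A, B, fun x => P (ℓ x.1) (ℓ x.2), fun c d => ?_⟩
  obtain ⟨γ, hγ⟩ := exists_circle_lift c
  obtain ⟨δ, hδ⟩ := exists_circle_lift d
  rw [turns_eq hγ, turns_eq hδ, turns_eq (θ := ⟨fun t => Θ (γ t, δ t), by fun_prop⟩)]
  · simp only [← hγ, ← hδ, hη, ContinuousMap.coe_mk, P]
    ring
  · intro t
    simp only [ContinuousMap.coe_mk, hlift, hγ, hδ]

section Torus

variable {X : Type*} [TopologicalSpace X] {T : Set X}

/-- In the solid torus glued in along the slope `p m + q l` the longitude is homologous to a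
multiple of `p` times the core, and this multiple is not zero. -/
theorem exists_core_turns {φ h : Circle × Circle ≃ₜ T} {p q : ℤ} (hp : 0 < p)
    (hpq : IsCoprime p q) (hslope : HasSlope φ h p q) :
    ∃ (A B : ℤ) (η : T → ℝ), B ≠ 0 ∧ ∀ c : C(I, T),
      turns ⟨fun t => (h.symm (c t)).2, by fun_prop⟩ =
        A * (torusTurns φ c).1 + (B * p : ℤ) * (torusTurns φ c).2 + (η (c 1) - η (c 0)) := by
  obtain ⟨A, B, η, hη⟩ := exists_degrees (F := fun x => (h.symm (φ x)).2) (by fun_prop)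
  have key : ∀ c : C(I, T), turns ⟨fun t => (h.symm (c t)).2, by fun_prop⟩ =
      A * (torusTurns φ c).1 + B * (torusTurns φ c).2 +
        (η (φ.symm (c 1)) - η (φ.symm (c 0))) := by
    intro c
    have := hη ⟨fun t => (φ.symm (c t)).1, by fun_prop⟩ ⟨fun t => (φ.symm (c t)).2, by fun_prop⟩
    simp only [ContinuousMap.coe_mk, Prod.mk.eta, Homeomorph.apply_symm_apply] at this
    exact this
  have hm := key ⟨fun t => h (circleLoop t, 1), by fun_prop⟩
  rw [hslope, turns_const _ 1 (by intro t; simp)] at hm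
  have hl := key ⟨fun t => h (1, circleLoop t), by fun_prop⟩
  have e1 : turns ⟨fun t => (h.symm ((⟨fun t => h (1, circleLoop t), by fun_prop⟩ : C(I, T)) t)).2,
      by fun_prop⟩ = 1 := by
    rw [← turns_circleLoop]
    congr 1
    ext t
    simp
  rw [e1] at hl
  have c0 : circleLoop 0 = 1 := by simp [circleLoop]
  have c1 : circleLoop 1 = 1 := by simp [circleLoop]
  simp only [ContinuousMap.coe_mk, c0, c1, sub_self, add_zero] at hm hl
  have hm' : A * p + B * q = 0 := by exact_mod_cast hm.symm
  -- The disc boundary makes no turns around the core, so `A p + B q = 0`, and `p` is prime to `q`.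
  obtain ⟨B', rfl⟩ : p ∣ B := by
    refine hpq.dvd_of_dvd_mul_right ⟨-A, ?_⟩
    linarith
  refine ⟨A, B', fun x => η (φ.symm x), ?_, fun c => ?_⟩
  -- If `B` vanished, so would `A`, yet the loop `h (1, ·)` makes one turn.
  · rintro rfl
    have : A = 0 := by
      have : A * p = 0 := by simpa using hm'
      exact (mul_eq_zero.1 this).resolve_right hp.ne'
    simp [this] at hl
  · rw [key c, mul_comm B' p]

end Torus

/-! ### Path classes carried by simply connected spaces -/

section PathClasses

variable {Y : Type*} [TopologicalSpace Y]

theorem symm_trans_trans {x y z : Y} (p : Path.Homotopic.Quotient y x)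
    (q : Path.Homotopic.Quotient x z) : p.symm.trans (p.trans q) = q := by
  rw [← Path.Homotopic.Quotient.trans_assoc, Path.Homotopic.Quotient.symm_trans,
    Path.Homotopic.Quotient.refl_trans]

variable {Z : Type*} [TopologicalSpace Z] [SimplyConnectedSpace Z] (Ψ : C(Z, Y))

/-- The image under `Ψ` of the unique class of paths from `z` to `z'` in the simply connected
space `Z`. -/
noncomputable def imageClass (z z' : Z) {x y : Y} (hx : Ψ z = x) (hy : Ψ z' = y) :
    Path.Homotopic.Quotient x y :=
  .mk (((PathConnectedSpace.somePath z z').map Ψ.continuous).cast hx.symm hy.symm)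

variable {Ψ}

/-- Paths in `Z` with the same ends are homotopic, so any lift computes the class. It is applied
both to a triangle and to the universal cover of the solid torus. -/
theorem mk_eq_imageClass {z z' : Z} {x y : Y} (hx : Ψ z = x) (hy : Ψ z' = y)
    (p : Path x y) (c : C(I, Z)) (h0 : c 0 = z) (h1 : c 1 = z') (hc : ∀ t, Ψ (c t) = p t) :
    Path.Homotopic.Quotient.mk p = imageClass Ψ z z' hx hy := by
  subst hx hy
  let q : Path z z' := ⟨c, h0, h1⟩
  have e : p = q.map Ψ.continuous := by
    ext t
    exact (hc t).symm
  subst e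
  exact Quotient.sound ((SimplyConnectedSpace.paths_homotopic q _).map Ψ)

theorem imageClass_trans {z z' z'' : Z} {x y w : Y} (hx : Ψ z = x) (hy : Ψ z' = y)
    (hw : Ψ z'' = w) :
    (imageClass Ψ z z' hx hy).trans (imageClass Ψ z' z'' hy hw) = imageClass Ψ z z'' hx hw := by
  refine Eq.trans ?_ (mk_eq_imageClass hx hw
    ((((PathConnectedSpace.somePath z z').map Ψ.continuous).cast hx.symm hy.symm).trans
      (((PathConnectedSpace.somePath z' z'').map Ψ.continuous).cast hy.symm hw.symm))
    ((PathConnectedSpace.somePath z z').trans (PathConnectedSpace.somePath z' z''))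
    (Path.source _) (Path.target _) ?_)
  · rfl
  · intro t
    subst hx hy hw
    exact congrArg (fun p : Path (Ψ z) (Ψ z'') => p t) (Path.map_trans _ _ Ψ.continuous)

theorem imageClass_self {z : Z} {x : Y} (hx : Ψ z = x) :
    imageClass Ψ z z hx hx = Path.Homotopic.Quotient.refl x :=
  (mk_eq_imageClass hx hx (Path.refl x) (ContinuousMap.const I z) rfl rfl fun _ => hx).symm

theorem symm_imageClass {z z' : Z} {x y : Y} (hx : Ψ z = x) (hy : Ψ z' = y) :
    (imageClass Ψ z z' hx hy).symm = imageClass Ψ z' z hy hx := by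
  have h := symm_trans_trans (imageClass Ψ z z' hx hy) (imageClass Ψ z' z hy hx)
  rwa [imageClass_trans, imageClass_self, Path.Homotopic.Quotient.trans_refl] at h

theorem imageClass_translate (τ : C(Z, Z)) (hτ : ∀ z, Ψ (τ z) = Ψ z) {z z' : Z} {x y : Y}
    (hx : Ψ z = x) (hy : Ψ z' = y) :
    imageClass Ψ (τ z) (τ z') ((hτ z).trans hx) ((hτ z').trans hy) = imageClass Ψ z z' hx hy := by
  refine (mk_eq_imageClass _ _ (((PathConnectedSpace.somePath z z').map
    Ψ.continuous).cast hx.symm hy.symm) (τ.comp (PathConnectedSpace.somePath z z')) ?_ ?_ ?_).symm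
  · simp
  · simp
  · intro t
    simp [hτ]

end PathClasses

/-! ### The cocycle of a map from the surface -/

namespace OrientedSurface

theorem edgePoint_support {V : Type*} (u v : V) (t : I) (z : V) (hz : edgePoint u v t z ≠ 0) :
    z = u ∨ z = v := by
  by_contra! h
  exact hz (by simp [edgePoint, h.1, h.2])

theorem edgePoint_zero {V : Type*} (u v : V) : edgePoint u v 0 = edgePoint u u 0 := by
  ext z; simp [edgePoint]

theorem edgePoint_one {V : Type*} (u v : V) : edgePoint u v 1 = edgePoint v v 0 := by
  ext z; simp [edgePoint]

theorem continuous_edgePoint {V : Type*} (u v : V) : Continuous (edgePoint u v) := by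
  refine continuous_pi fun z => ?_
  unfold edgePoint
  fun_prop

variable {V : Type*} [Fintype V] (K : OrientedSurface V)

/-- `u` and `v` span an edge. -/
def IsEdge (u v : V) : Prop := ∃ w, K.tri u v w ∨ K.tri v u w

variable {K}

theorem IsEdge.symm {u v : V} (h : K.IsEdge u v) : K.IsEdge v u := by
  obtain ⟨w, hw⟩ := h
  exact ⟨w, hw.symm⟩

theorem edgePoint_mem_stdSimplex (u v : V) (t : I) : edgePoint u v t ∈ stdSimplex ℝ V := by
  classical
  refine ⟨fun z => ?_, ?_⟩
  · have h0 := t.2.1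
    have h1 := sub_nonneg.2 t.2.2
    simp only [edgePoint]
    positivity
  · simp only [edgePoint, Finset.sum_add_distrib, ← Finset.mul_sum]
    simp

variable (K) in
/-- A vertex, as a point of the geometric realization. -/
noncomputable def vertexPoint (v : V) : K.Realization :=
  ⟨edgePoint v v 0, edgePoint_mem_stdSimplex v v 0, by
    obtain ⟨u, w, h⟩ := K.pure v
    exact ⟨v, u, w, h, fun z hz => Or.inl ((edgePoint_support v v 0 z hz).elim id id)⟩⟩

/-- The straight path along an edge. -/
noncomputable def segment {u v : V} (h : K.IsEdge u v) : Path (K.vertexPoint u) (K.vertexPoint v) where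
  toFun t := ⟨edgePoint u v t, edgePoint_mem_stdSimplex u v t, by
    obtain ⟨w, h | h⟩ := h
    · refine ⟨u, v, w, h, fun z hz => ?_⟩
      rcases edgePoint_support u v t z hz with h | h <;> simp [h]
    · refine ⟨v, u, w, h, fun z hz => ?_⟩
      rcases edgePoint_support u v t z hz with h | h <;> simp [h]⟩
  continuous_toFun := Continuous.subtype_mk (continuous_edgePoint u v) _
  source' := Subtype.ext (edgePoint_zero u v)
  target' := Subtype.ext (edgePoint_one u v)

theorem segment_symm {u v : V} (h : K.IsEdge u v) : segment h.symm = (segment h).symm := by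
  ext t
  refine Subtype.ext (funext fun z => ?_)
  change edgePoint v u t z = edgePoint u v (unitInterval.symm t) z
  simp only [edgePoint, unitInterval.coe_symm_eq]
  ring

/-- The closed simplex with vertices `u`, `v` and `w`. -/
def simplex (u v w : V) : Set (V → ℝ) :=
  {x | x ∈ stdSimplex ℝ V ∧ ∀ z, x z ≠ 0 → z = u ∨ z = v ∨ z = w}

theorem convex_simplex (u v w : V) : Convex ℝ (simplex u v w) := by
  intro x hx y hy a b ha hb hab
  refine ⟨convex_stdSimplex ℝ V hx.1 hy.1 ha hb hab, fun z hz => ?_⟩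
  by_cases h1 : x z = 0
  · by_cases h2 : y z = 0
    · simp [h1, h2] at hz
    · exact hy.2 z h2
  · exact hx.2 z h1

/-- The inclusion of a triangle. -/
def simplexMap {u v w : V} (h : K.tri u v w) : C(simplex u v w, K.Realization) where
  toFun x := ⟨x.1, x.2.1, u, v, w, h, x.2.2⟩
  continuous_toFun := Continuous.subtype_mk continuous_subtype_val _

theorem edgePoint_mem_simplex {u v w x y : V} (hx : x = u ∨ x = v ∨ x = w)
    (hy : y = u ∨ y = v ∨ y = w) (t : I) : edgePoint x y t ∈ simplex u v w :=
  ⟨edgePoint_mem_stdSimplex x y t, fun z hz => by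
    rcases edgePoint_support x y t z hz with rfl | rfl <;> assumption⟩

theorem simplyConnectedSpace_simplex (u v w : V) : SimplyConnectedSpace (simplex u v w) := by
  have : ContractibleSpace (simplex u v w) :=
    (convex_simplex u v w).contractibleSpace ⟨_, edgePoint_mem_simplex (x := u) (y := u)
      (Or.inl rfl) (Or.inl rfl) 0⟩
  infer_instance

variable {Y : Type*} [TopologicalSpace Y] (F : C(K.Realization, Y))

/-- The class of the image of an edge. -/
noncomputable def edgeClass {u v : V} (h : K.IsEdge u v) :
    Path.Homotopic.Quotient (F (K.vertexPoint u)) (F (K.vertexPoint v)) :=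
  .mk ((segment h).map F.continuous)

theorem edgeClass_symm {u v : V} (h : K.IsEdge u v) :
    edgeClass F h.symm = (edgeClass F h).symm := by
  have : (segment h.symm).map F.continuous = ((segment h).map F.continuous).symm := by
    rw [segment_symm, Path.map_symm]
  rw [edgeClass, this, edgeClass, Path.Homotopic.Quotient.mk_symm]

theorem edgeClass_triangle {u v w : V} (h : K.tri u v w) (huw : K.IsEdge u w)
    (hwv : K.IsEdge w v) (hvu : K.IsEdge v u) :
    (edgeClass F huw).trans ((edgeClass F hwv).trans (edgeClass F hvu)) = .refl _ := by
  have := simplyConnectedSpace_simplex u v w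
  have hu : u = u ∨ u = v ∨ u = w := Or.inl rfl
  have hv : v = u ∨ v = v ∨ v = w := Or.inr (Or.inl rfl)
  have hw : w = u ∨ w = v ∨ w = w := Or.inr (Or.inr rfl)
  let Ψ : C(simplex u v w, Y) := F.comp (simplexMap h)
  let pt (x : V) (hx : x = u ∨ x = v ∨ x = w) : simplex u v w :=
    ⟨edgePoint x x 0, edgePoint_mem_simplex hx hx 0⟩
  have hpt : ∀ x hx, Ψ (pt x hx) = F (K.vertexPoint x) := fun x hx => rfl
  have key : ∀ {x y : V} (hx : x = u ∨ x = v ∨ x = w) (hy : y = u ∨ y = v ∨ y = w)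
      (hxy : K.IsEdge x y), edgeClass F hxy = imageClass Ψ (pt x hx) (pt y hy)
        (hpt x hx) (hpt y hy) := by
    intro x y hx hy hxy
    refine mk_eq_imageClass (hpt x hx) (hpt y hy) ((segment hxy).map F.continuous)
      ⟨fun t => ⟨edgePoint x y t, edgePoint_mem_simplex hx hy t⟩,
        Continuous.subtype_mk (continuous_edgePoint x y) _⟩
      (Subtype.ext (edgePoint_zero x y)) (Subtype.ext (edgePoint_one x y)) fun t => rfl
  rw [key hu hw huw, key hw hv hwv, key hv hu hvu, imageClass_trans, imageClass_trans,
    imageClass_self]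

variable {b : Y} (Γ : ∀ v, Path.Homotopic.Quotient b (F (K.vertexPoint v)))

open Classical in
/-- The cocycle of a map `F` from a surface with values in the fundamental group, defined by paths
`Γ` from the base point to the images of the vertices. -/
noncomputable def cocycle (d : V × V) : FundamentalGroup Y b :=
  if h : K.IsEdge d.1 d.2 then
    -- The product in `FundamentalGroup` is concatenation in reverse order, so the edge is traversed
    -- backwards to make labels multiply in the order of the walk.
    FundamentalGroup.fromPath ((Γ d.2).trans ((edgeClass F h.symm).trans (Γ d.1).symm))
  else 1

variable {F Γ}

theorem cocycle_of_isEdge {u v : V} (h : K.IsEdge u v) :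
    cocycle F Γ (u, v) =
      FundamentalGroup.fromPath ((Γ v).trans ((edgeClass F h.symm).trans (Γ u).symm)) := dif_pos h

theorem cocycle_swap {u v : V} (h : K.IsEdge u v) :
    cocycle F Γ (v, u) = (cocycle F Γ (u, v))⁻¹ := by
  rw [cocycle_of_isEdge h, cocycle_of_isEdge h.symm, eq_inv_iff_mul_eq_one,
    FundamentalGroup.mul_def, FundamentalGroup.one_def, edgeClass_symm F h]
  simp only [Path.Homotopic.Quotient.trans_assoc, symm_trans_trans,
    Path.Homotopic.Quotient.trans_symm]

theorem cocycle_triangle {u v w : V} (h : K.tri u v w) :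
    cocycle F Γ (u, v) * cocycle F Γ (v, w) * cocycle F Γ (w, u) = 1 := by
  have huv : K.IsEdge u v := ⟨w, Or.inl h⟩
  have hvw : K.IsEdge v w := ⟨u, Or.inl (K.rotate h)⟩
  have hwu : K.IsEdge w u := ⟨v, Or.inl (K.rotate (K.rotate h))⟩
  have key := edgeClass_triangle F h hwu.symm hvw.symm huv.symm
  rw [cocycle_of_isEdge huv, cocycle_of_isEdge hvw, cocycle_of_isEdge hwu,
    FundamentalGroup.mul_def, FundamentalGroup.mul_def, FundamentalGroup.one_def]
  have e : ∀ (q : Path.Homotopic.Quotient (F (K.vertexPoint u)) b),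
      (edgeClass F hwu.symm).trans ((edgeClass F hvw.symm).trans
        ((edgeClass F huv.symm).trans q)) = q := by
    intro q
    rw [← Path.Homotopic.Quotient.trans_assoc, ← Path.Homotopic.Quotient.trans_assoc,
      Path.Homotopic.Quotient.trans_assoc (edgeClass F hwu.symm), key,
      Path.Homotopic.Quotient.refl_trans]
  simp only [Path.Homotopic.Quotient.trans_assoc, symm_trans_trans, e,
    Path.Homotopic.Quotient.trans_symm]

end OrientedSurface

/-- The boundary of a boundary is zero. Over all positive sides of triangles the sum vanishes by
rotating the triangles, and the interior sides cancel with their reversals. -/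
theorem OrientedSurface.sum_boundaryEdge_sub {V : Type*} [Fintype V] (K : OrientedSurface V)
    (s : V → ℝ) : ∑ e : K.BoundaryEdge, (s e.1.2 - s e.1.1) = 0 := by
  classical
  let D : Finset (V × V) := Finset.univ.filter fun d => ∃ w, K.tri d.1 d.2 w
  have hD : ∀ d, d ∈ D ↔ ∃ w, K.tri d.1 d.2 w := fun d => by simp [D]
  have h1 : ∑ d ∈ D, s d.2 = ∑ d ∈ D, s d.1 := by
    refine Finset.sum_bij (fun d hd => (d.2, ((hD d).1 hd).choose)) ?_ ?_ ?_ ?_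
    · intro d hd
      exact (hD _).2 ⟨_, K.rotate ((hD d).1 hd).choose_spec⟩
    · rintro ⟨u, v⟩ hd ⟨u', v'⟩ hd' he
      simp only [Prod.mk.injEq] at he
      obtain ⟨rfl, he⟩ := he
      have a1 := K.rotate ((hD _).1 hd).choose_spec
      have a2 := K.rotate ((hD _).1 hd').choose_spec
      rw [← he] at a2
      exact Prod.ext (K.coherent a1 a2) rfl
    · rintro ⟨v, w⟩ hd
      obtain ⟨u, hu⟩ := (hD _).1 hd
      have hu' := K.rotate (K.rotate hu)
      refine ⟨(u, v), (hD _).2 ⟨_, hu'⟩, ?_⟩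
      have := ((hD (u, v)).1 ((hD _).2 ⟨_, hu'⟩)).choose_spec
      exact Prod.ext rfl (K.coherent this hu')
    · intros; rfl
  have h2 : ∑ d ∈ D with ¬ K.IsBoundaryEdge d.1 d.2, (s d.2 - s d.1) = 0 := by
    refine Finset.sum_involution (fun d _ => d.swap) ?_ ?_ ?_ ?_
    · intros; simp
    · rintro ⟨u, v⟩ hd hne he
      simp only [Prod.swap_prod_mk, Prod.mk.injEq] at he
      exact hne (by simp [he.1])
    · intro d hd
      simp only [Finset.mem_filter, hD, OrientedSurface.IsBoundaryEdge, not_and, not_not] at hd ⊢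
      exact ⟨hd.2 hd.1, fun _ => hd.1⟩
    · intros; simp
  have h3 : ∑ e : K.BoundaryEdge, (s e.1.2 - s e.1.1) =
      ∑ d ∈ D with K.IsBoundaryEdge d.1 d.2, (s d.2 - s d.1) := by
    refine Finset.sum_bij (fun (e : K.BoundaryEdge) _ => e.1) ?_ ?_ ?_ ?_
    · rintro ⟨d, hb⟩ -
      exact Finset.mem_filter.2 ⟨(hD d).2 hb.1, hb⟩
    · rintro ⟨d, hb⟩ - ⟨d', hb'⟩ - rfl
      rfl
    · intro d hd
      exact ⟨⟨d, (Finset.mem_filter.1 hd).2⟩, Finset.mem_univ _, rfl⟩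
    · intros; rfl
  have h4 := Finset.sum_filter_add_sum_filter_not D (fun d => K.IsBoundaryEdge d.1 d.2)
    fun d => s d.2 - s d.1
  have h5 : ∑ d ∈ D, (s d.2 - s d.1) = 0 := by rw [Finset.sum_sub_distrib, h1, sub_self]
  rw [h2, add_zero, h5] at h4
  exact h3.trans h4

/-! ### Paths in the filling solid torus as powers of the core -/

/-- The universal cover of the solid torus. -/
def solidCover : Set (ℂ × ℝ) := {x | x.1 ∈ Metric.closedBall (0 : ℂ) 1}

instance : SimplyConnectedSpace solidCover := by
  have hc : Convex ℝ solidCover :=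
    (convex_closedBall (0 : ℂ) 1).is_linear_preimage
      (f := fun x : ℂ × ℝ => x.1) ⟨fun _ _ => rfl, fun _ _ => rfl⟩
  have : ContractibleSpace solidCover := hc.contractibleSpace ⟨(0, 0), by simp [solidCover]⟩
  infer_instance

/-- The deck transformations of the universal cover of the solid torus. -/
def deck (k : ℤ) : C(solidCover, solidCover) where
  toFun x := ⟨(x.1.1, x.1.2 + k), x.2⟩
  continuous_toFun := by fun_prop

/-- The points over the core circle. -/
def coverCore (s : ℝ) : solidCover := ⟨(0, s), by simp [solidCover]⟩

/-- The points over the boundary of the solid torus. -/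
def coverBoundary (z : Circle) (s : ℝ) : solidCover := ⟨(z, s), by simp [solidCover, Circle.norm_coe]⟩

section Torus

variable {X : Type*} [TopologicalSpace X] {T : Set X} (h : Circle × Circle ≃ₜ T)

/-- The inclusion of `X` in its filling. -/
def toFilling : C(X, Filling h) where
  toFun x := Quot.mk _ (Sum.inl x)
  continuous_toFun := continuous_quot_mk.comp continuous_inl

/-- The map from the universal cover of the solid torus to the filling. -/
noncomputable def coverMap : C(solidCover, Filling h) where
  toFun x := Quot.mk _ (Sum.inr (⟨x.1.1, x.2⟩, Circle.exp (2 * Real.pi * x.1.2)))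
  continuous_toFun := by
    refine continuous_quot_mk.comp (continuous_inr.comp ?_)
    exact Continuous.prodMk (Continuous.subtype_mk (by fun_prop) _) (by fun_prop)

theorem coverMap_deck (k : ℤ) (z : solidCover) : coverMap h (deck k z) = coverMap h z := by
  have : Circle.exp (2 * Real.pi * (z.1.2 + k)) = Circle.exp (2 * Real.pi * z.1.2) :=
    exp_two_pi_eq_iff.2 ⟨k, by ring⟩
  exact congrArg (fun y => (Quot.mk _ (Sum.inr (⟨z.1.1, z.2⟩, y)) : Filling h)) this

theorem coverMap_coverCore (k : ℤ) : coverMap h (coverCore k) = corePoint h 1 := by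
  have : Circle.exp (2 * Real.pi * k) = 1 := by
    rw [← Circle.exp_zero, ← mul_zero (2 * Real.pi)]
    exact exp_two_pi_eq_iff.2 ⟨k, by ring⟩
  exact congrArg (corePoint h) this

theorem coverMap_coverBoundary (x : T) {s : ℝ}
    (hs : Circle.exp (2 * Real.pi * s) = (h.symm x).2) :
    coverMap h (coverBoundary (h.symm x).1 s) = toFilling h (x : X) := by
  have e := Quot.sound (GlueRel.glue (h := h) (h.symm x))
  rw [Homeomorph.apply_symm_apply] at e
  refine Eq.trans ?_ e.symm
  exact congrArg (fun y => (Quot.mk _ (Sum.inr (⟨((h.symm x).1 : ℂ),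
    by simp [Circle.norm_coe]⟩, y)) : Filling h)) hs

/-- The class of the core circle. -/
noncomputable def coreClass : FundamentalGroup (Filling h) (corePoint h 1) :=
  FundamentalGroup.fromPath (Path.Homotopic.Quotient.mk (coreLoop h))

theorem imageClass_coverCore (k : ℤ) :
    FundamentalGroup.fromPath (imageClass (coverMap h) (coverCore (0 : ℤ)) (coverCore k)
      (coverMap_coverCore h 0) (coverMap_coverCore h k)) = coreClass h ^ k := by
  let f : ℤ → FundamentalGroup (Filling h) (corePoint h 1) := fun k =>
    FundamentalGroup.fromPath (imageClass (coverMap h) (coverCore (0 : ℤ)) (coverCore k)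
      (coverMap_coverCore h 0) (coverMap_coverCore h k))
  have hadd : ∀ m n, f (m + n) = f n * f m := by
    intro m n
    have e0 : deck m (coverCore (0 : ℤ)) = coverCore m := by simp [deck, coverCore]
    have e1 : deck m (coverCore n) = coverCore ((m + n : ℤ) : ℝ) := by
      simp [deck, coverCore, add_comm]
    have h1 := imageClass_translate (deck m) (coverMap_deck h m) (coverMap_coverCore h 0)
      (coverMap_coverCore h n)
    have h2 : imageClass (coverMap h) (coverCore m) (coverCore ((m + n : ℤ) : ℝ))
        (coverMap_coverCore h m) (coverMap_coverCore h (m + n)) =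
        imageClass (coverMap h) (coverCore (0 : ℤ)) (coverCore n)
          (coverMap_coverCore h 0) (coverMap_coverCore h n) := by
      rw [← h1]
      congr 1 <;> simp only [e0, e1]
    rw [FundamentalGroup.mul_def]
    exact (imageClass_trans (coverMap_coverCore h 0) (coverMap_coverCore h m)
      (coverMap_coverCore h (m + n))).symm.trans (by rw [h2])
  have hone : f 1 = coreClass h := by
    refine (mk_eq_imageClass (Ψ := coverMap h) _ _ (coreLoop h)
      ⟨fun t => coverCore t, ?_⟩ ?_ ?_ ?_).symm
    · unfold coverCore
      fun_prop
    · simp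
    · simp
    · intro t
      rfl
  let φ : Multiplicative ℤ →* FundamentalGroup (Filling h) (corePoint h 1) :=
    MonoidHom.mk' (fun k => f k.toAdd) (by
      intro a b
      rw [toAdd_mul, add_comm]
      exact hadd _ _)
  have := MonoidHom.apply_mint _ φ (Multiplicative.ofAdd k)
  change f k = f 1 ^ k at this
  rw [← hone]
  exact this

/-- A path on the glued torus, closed up in the solid torus, is a power of the core circle. -/
theorem torus_path_class (c : C(I, T)) {x₀ x₁ : T} (hx₀ : c 0 = x₀) (hx₁ : c 1 = x₁) {s₀ s₁ : ℝ}
    {k : ℤ} (h₀ : Circle.exp (2 * Real.pi * s₀) = (h.symm x₀).2)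
    (h₁ : Circle.exp (2 * Real.pi * s₁) = (h.symm x₁).2)
    (hk : turns ⟨fun t => (h.symm (c t)).2, by fun_prop⟩ = s₁ - s₀ + k)
    (P : Path (toFilling h (x₀ : X)) (toFilling h (x₁ : X)))
    (hP : ∀ t, P t = toFilling h (c t : X)) :
    FundamentalGroup.fromPath ((imageClass (coverMap h) (coverCore (0 : ℤ))
      (coverBoundary (h.symm x₀).1 s₀) (coverMap_coverCore h 0)
      (coverMap_coverBoundary h x₀ h₀)).trans ((Path.Homotopic.Quotient.mk P).trans
      (imageClass (coverMap h) (coverCore (0 : ℤ)) (coverBoundary (h.symm x₁).1 s₁)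
        (coverMap_coverCore h 0) (coverMap_coverBoundary h x₁ h₁)).symm)) =
    coreClass h ^ k := by
  subst hx₀ hx₁
  obtain ⟨θ, hθ⟩ := exists_circle_lift ⟨fun t => (h.symm (c t)).2, by fun_prop⟩
  simp only [ContinuousMap.coe_mk] at hθ
  rw [turns_eq hθ] at hk
  obtain ⟨j, hj⟩ := exp_two_pi_eq_iff.1 (h₀.trans (hθ 0).symm)
  have e1 : deck k (coverBoundary (h.symm (c 1)).1 s₁) =
      coverBoundary (h.symm (c 1)).1 (s₁ + k) := rfl
  have e0 : deck k (coverCore (0 : ℤ)) = coverCore k := by simp [deck, coverCore]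
  have h₁' : Circle.exp (2 * Real.pi * (s₁ + k)) = (h.symm (c 1)).2 := by
    rw [← h₁]
    exact exp_two_pi_eq_iff.2 ⟨k, by ring⟩
  -- The angle lift, shifted by `j` to start at height `s₀`, ends at `s₁ + k`. Translating the
  -- closing path by `deck k` then makes the lifted loop run along the cover from height `0` to
  -- height `k` over the core.
  have hmk : Path.Homotopic.Quotient.mk P = imageClass (coverMap h)
      (coverBoundary (h.symm (c 0)).1 s₀) (coverBoundary (h.symm (c 1)).1 (s₁ + k))
      (coverMap_coverBoundary h (c 0) h₀) (coverMap_coverBoundary h (c 1) h₁') := by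
    refine mk_eq_imageClass _ _ P
      ⟨fun t => coverBoundary (h.symm (c t)).1 (θ t + j), ?_⟩ ?_ ?_ ?_
    · unfold coverBoundary
      fun_prop
    · simp only [ContinuousMap.coe_mk]
      congr 1
      linarith
    · simp only [ContinuousMap.coe_mk]
      congr 1
      linarith
    · intro t
      rw [hP]
      refine coverMap_coverBoundary h (c t) ?_
      rw [← hθ]
      exact exp_two_pi_eq_iff.2 ⟨j, by ring⟩
  have htr : imageClass (coverMap h) (coverBoundary (h.symm (c 1)).1 s₁) (coverCore (0 : ℤ))
      (coverMap_coverBoundary h (c 1) h₁) (coverMap_coverCore h 0) =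
      imageClass (coverMap h) (coverBoundary (h.symm (c 1)).1 (s₁ + k)) (coverCore k)
      (coverMap_coverBoundary h (c 1) h₁') (coverMap_coverCore h k) := by
    have := imageClass_translate (deck k) (coverMap_deck h k)
      (coverMap_coverBoundary h (c 1) h₁) (coverMap_coverCore h 0)
    rw [← this]
    congr 1
  rw [hmk, symm_imageClass, htr, imageClass_trans, imageClass_trans]
  exact imageClass_coverCore h k

end Torus

/-! ### The relation on the core given by the surface -/

section Torus

variable {X : Type*} [TopologicalSpace X] {T : Set X}

theorem exists_int_turns (c : C(I, Circle)) {s₀ s₁ : ℝ}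
    (h₀ : Circle.exp (2 * Real.pi * s₀) = c 0) (h₁ : Circle.exp (2 * Real.pi * s₁) = c 1) :
    ∃ k : ℤ, turns c = s₁ - s₀ + k := by
  obtain ⟨θ, hθ⟩ := exists_circle_lift c
  obtain ⟨i, hi⟩ := exp_two_pi_eq_iff.1 ((hθ 0).trans h₀.symm)
  obtain ⟨j, hj⟩ := exp_two_pi_eq_iff.1 ((hθ 1).trans h₁.symm)
  refine ⟨j - i, ?_⟩
  rw [turns_eq hθ]
  push_cast
  linarith

/-- A surface that bounds `n` times the longitude gives a relation on the core of the filling. -/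
theorem exists_surfaceRel_coreClass {φ h : Circle × Circle ≃ₜ T} {V : Type*} [Fintype V]
    {K : OrientedSurface V} {f : C(K.Realization, X)} {n : ℕ} (hn : 0 < n)
    (hS : BoundsLongitude φ K f n) {p q : ℤ} (hp : 0 < p) (hpq : IsCoprime p q)
    (hslope : HasSlope φ h p q) :
    ∃ (r : ℕ) (N : ℤ), (r : ℤ) ≤ 2 - K.eulerChar ∧ N ≠ 0 ∧ n * p ≤ |N| ∧
      SurfaceRel (coreClass h) r N 1 := by
  classical
  obtain ⟨hf, hsum⟩ := hS
  obtain ⟨A, B, η, hB, hη⟩ := exists_core_turns hp hpq hslope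
  let c (e : K.BoundaryEdge) : C(I, T) := ⟨fun t => ⟨f (K.edgePath e t), hf e t⟩, by fun_prop⟩
  have hc0 : ∀ e, (c e 0 : X) = f (K.vertexPoint e.1.1) := fun e =>
    congrArg f (Subtype.ext (OrientedSurface.edgePoint_zero e.1.1 e.1.2))
  have hc1 : ∀ e, (c e 1 : X) = f (K.vertexPoint e.1.2) := fun e =>
    congrArg f (Subtype.ext (OrientedSurface.edgePoint_one e.1.1 e.1.2))
  have hne : Nonempty K.BoundaryEdge := by
    by_contra hcon
    rw [not_nonempty_iff] at hcon
    rw [Finset.univ_eq_empty, Finset.sum_empty] at hsum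
    have := congrArg Prod.snd hsum
    simp only [Prod.snd_zero] at this
    exact hn.ne (by exact_mod_cast this)
  obtain ⟨e₀⟩ := hne
  have : Nonempty V := ⟨e₀.1.1⟩
  let F : C(K.Realization, Filling h) := (toFilling h).comp f
  choose ℓ hℓ using exp_two_pi_surjective
  have hin : ∀ v, ∀ hv : f (K.vertexPoint v) ∈ T,
      Joined (corePoint h 1) (F (K.vertexPoint v)) := by
    intro v hv
    have e := coverMap_coverBoundary h ⟨_, hv⟩ (hℓ _)
    exact ⟨((PathConnectedSpace.somePath (coverCore (0 : ℤ)) (coverBoundary _ _)).map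
      (coverMap h).continuous).cast (coverMap_coverCore h 0).symm e.symm⟩
  have hjoin : ∀ v, Joined (corePoint h 1) (F (K.vertexPoint v)) := by
    have step : ∀ u v, Joined (F (K.vertexPoint u)) (F (K.vertexPoint v)) := by
      intro u v
      induction K.connected u v with
      | rel x y hxy =>
        obtain ⟨z, hz⟩ := hxy
        exact ⟨(OrientedSurface.segment (K := K) ⟨z, Or.inl hz⟩).map F.continuous⟩
      | refl => exact Joined.refl _
      | symm _ _ _ ih => exact ih.symm
      | trans _ _ _ _ _ ih1 ih2 => exact ih1.trans ih2
    intro v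
    exact (hin e₀.1.1 (hc0 e₀ ▸ (c e₀ 0).2)).trans (step _ v)
  -- Base paths to vertices on the torus run through the solid torus, ending at a chosen height `s
  -- v` of the cover. Elsewhere the path is arbitrary and the default `0` is harmless, as all
  -- boundary vertices map into `T`.
  let s : V → ℝ := fun v =>
    if hv : f (K.vertexPoint v) ∈ T then ℓ (h.symm ⟨_, hv⟩).2 else 0
  let η' : V → ℝ := fun v => if hv : f (K.vertexPoint v) ∈ T then η ⟨_, hv⟩ else 0
  let Γ : ∀ v, Path.Homotopic.Quotient (corePoint h 1) (F (K.vertexPoint v)) := fun v =>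
    if hv : f (K.vertexPoint v) ∈ T then
      imageClass (coverMap h) (coverCore (0 : ℤ))
        (coverBoundary (h.symm ⟨_, hv⟩).1 (ℓ (h.symm ⟨_, hv⟩).2)) (coverMap_coverCore h 0)
        (coverMap_coverBoundary h ⟨_, hv⟩ (hℓ _))
    else .mk (hjoin v).somePath
  have hk : ∀ e : K.BoundaryEdge, ∃ k : ℤ,
      turns ⟨fun t => (h.symm (c e t)).2, by fun_prop⟩ = s e.1.2 - s e.1.1 + k ∧
      OrientedSurface.cocycle F Γ (e.1.2, e.1.1) = coreClass h ^ k := by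
    intro e
    have m0 : f (K.vertexPoint e.1.1) ∈ T := hc0 e ▸ (c e 0).2
    have m1 : f (K.vertexPoint e.1.2) ∈ T := hc1 e ▸ (c e 1).2
    have q0 : c e 0 = ⟨_, m0⟩ := Subtype.ext (hc0 e)
    have q1 : c e 1 = ⟨_, m1⟩ := Subtype.ext (hc1 e)
    have s0 : s e.1.1 = ℓ (h.symm ⟨_, m0⟩).2 := dif_pos m0
    have s1 : s e.1.2 = ℓ (h.symm ⟨_, m1⟩).2 := dif_pos m1
    obtain ⟨k, hk⟩ := exists_int_turns ⟨fun t => (h.symm (c e t)).2, by fun_prop⟩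
      (s₀ := ℓ (h.symm ⟨_, m0⟩).2) (s₁ := ℓ (h.symm ⟨_, m1⟩).2)
      ((hℓ _).trans (by rw [← q0]; rfl)) ((hℓ _).trans (by rw [← q1]; rfl))
    refine ⟨k, by rw [s0, s1, hk], ?_⟩
    have hedge : K.IsEdge e.1.1 e.1.2 := by
      obtain ⟨⟨w, hw⟩, -⟩ := e.2
      exact ⟨w, Or.inl hw⟩
    have main := torus_path_class h (c e) q0 q1 (hℓ _) (hℓ _) hk
      ((OrientedSurface.segment hedge).map F.continuous) fun t => rfl
    rw [OrientedSurface.cocycle_of_isEdge hedge.symm, ← main]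
    have g0 : Γ e.1.1 = _ := dif_pos m0
    have g1 : Γ e.1.2 = _ := dif_pos m1
    rw [g0, g1]
    rfl
  choose κ hκ hκ' using hk
  -- The sign comes from the reversed direction in `cocycle`; only `|N|` matters in the end.
  let k : V × V → ℤ := fun d => if hb : K.IsBoundaryEdge d.1 d.2 then -κ ⟨d, hb⟩ else 0
  have hkk : ∀ e : K.BoundaryEdge, k e.1 = -κ e := fun e => dif_pos e.2
  obtain ⟨r, hr, hrel⟩ := K.exists_surfaceRel (a := coreClass h)
    (g := OrientedSurface.cocycle F Γ) (k := k)
    (fun u v w huvw => OrientedSurface.cocycle_triangle huvw)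
    (fun u v w huvw => OrientedSurface.cocycle_swap ⟨w, Or.inl huvw⟩)
    (fun e => by
      obtain ⟨⟨w, hw⟩, -⟩ := e.2
      have := OrientedSurface.cocycle_swap (F := F) (Γ := Γ) (K := K) (u := e.1.2) (v := e.1.1)
        ⟨w, Or.inr hw⟩
      rw [hkk, zpow_neg, ← hκ' e]
      exact this)
  have hN : ∑ e : K.BoundaryEdge, k e.1 = -(B * p * n) := by
    have hcoord : ∑ e, torusTurns φ (c e) = (0, (n : ℝ)) := hsum
    have t1 : ∑ e, (torusTurns φ (c e)).1 = 0 := by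
      rw [← Prod.fst_sum, hcoord]
    have t2 : ∑ e, (torusTurns φ (c e)).2 = n := by
      rw [← Prod.snd_sum, hcoord]
    have hκR : ∀ e, (κ e : ℝ) = A * (torusTurns φ (c e)).1 +
        (B * p : ℤ) * (torusTurns φ (c e)).2 + (η' e.1.2 - η' e.1.1) -
        (s e.1.2 - s e.1.1) := by
      intro e
      have m0 : f (K.vertexPoint e.1.1) ∈ T := hc0 e ▸ (c e 0).2
      have m1 : f (K.vertexPoint e.1.2) ∈ T := hc1 e ▸ (c e 1).2
      have q0 : c e 0 = ⟨_, m0⟩ := Subtype.ext (hc0 e)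
      have q1 : c e 1 = ⟨_, m1⟩ := Subtype.ext (hc1 e)
      have r0 : η' e.1.1 = η (c e 0) := by rw [q0]; exact dif_pos m0
      have r1 : η' e.1.2 = η (c e 1) := by rw [q1]; exact dif_pos m1
      have := hκ e
      rw [hη (c e)] at this
      rw [r0, r1]
      linarith
    -- The heights `s` and the correction `η'` telescope away, and the boundary class `(0, n)` kills
    -- the term with `A`.
    have hR : ((∑ e, κ e : ℤ) : ℝ) = (B * p : ℤ) * n := by
      push_cast
      simp only [hκR, Finset.sum_sub_distrib (f := fun e : K.BoundaryEdge => _ + _),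
        Finset.sum_add_distrib]
      rw [K.sum_boundaryEdge_sub, K.sum_boundaryEdge_sub, ← Finset.mul_sum, ← Finset.mul_sum,
        t1, t2]
      push_cast
      ring
    have hZ : ∑ e, κ e = B * p * n := by exact_mod_cast hR
    simp only [hkk, Finset.sum_neg_distrib, hZ]
  have hB1 : 1 ≤ |B| := Int.one_le_abs hB
  have hn' : (0 : ℤ) < n := by exact_mod_cast hn
  refine ⟨r, _, hr, ?_, ?_, hrel⟩
  · rw [hN, neg_ne_zero]
    positivity
  · rw [hN, abs_neg, abs_mul, abs_mul, abs_of_pos hp, abs_of_pos hn']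
    nlinarith [mul_pos hn' hp]

end Torus

end DehnScl

/-! ### The estimate -/

theorem mainTheorem6
    {M : Type*} [TopologicalSpace M] [T2Space M] [SecondCountableTopology M] [ConnectedSpace M]
    [ChartedSpace (EuclideanHalfSpace 3) M]
    (φ : Circle × Circle ≃ₜ (𝓡∂ 3).boundary M)
    {V : Type*} [Fintype V] (S : DehnScl.OrientedSurface V)
    (f : C(S.Realization, M)) (n : ℕ) (hn : 0 < n) (hS : DehnScl.BoundsLongitude φ S f n)
    (p q : ℤ) (hp : 0 < p) (hpq : IsCoprime p q)
    (h : Circle × Circle ≃ₜ (𝓡∂ 3).boundary M) (hslope : DehnScl.HasSlope φ h p q)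
    {x : DehnScl.Filling h} (a : FundamentalGroup (DehnScl.Filling h) x)
    (ha : DehnScl.IsCoreClass h a)
    (hdisc : S.eulerChar ≤ 0 ∨ ¬ IsOfFinOrder a) :
    ((DehnScl.scl a : ENNReal) : EReal) ≤
      ((-((S.eulerChar : ℝ) / (n : ℝ)) / (2 * (p : ℝ)) : ℝ) : EReal) := by
  obtain ⟨r, N, hr, hN, hNn, hrel⟩ := DehnScl.exists_surfaceRel_coreClass hn hS hp hpq hslope
  obtain ⟨δ, rfl⟩ := ha
  rw [DehnScl.scl_mulEquiv]
  -- This must come before the comparison: `r - 2` is truncated, so `r - 2 ≤ -χ` would fail for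
  -- positive `χ`.
  have hχ : S.eulerChar ≤ 0 := by
    by_contra hpos
    apply hdisc.resolve_left hpos
    have h1 : IsConj 1 (DehnScl.coreClass h ^ N) := hrel.isConj_of_le_one (by omega)
    rw [isConj_one_right] at h1
    have h2 : IsOfFinOrder (DehnScl.coreClass h) := isOfFinOrder_iff_zpow_eq_one.2 ⟨N, hN, h1⟩
    exact MonoidHom.isOfFinOrder (MulEquiv.toMonoidHom _) h2
  have hle := DehnScl.scl_le_of_surfaceRel hrel hN
  have hpR : (0 : ℝ) < p := by exact_mod_cast hp
  have hnR : (0 : ℝ) < n := by exact_mod_cast hn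
  have hNR : (n : ℝ) * p ≤ |(N : ℝ)| := by exact_mod_cast hNn
  have hrR : ((r - 2 : ℕ) : ℝ) ≤ -(S.eulerChar : ℝ) := by
    have : ((r - 2 : ℕ) : ℤ) ≤ -S.eulerChar := by omega
    exact_mod_cast this
  have hbound : ((r - 2 : ℕ) : ℝ) / (2 * |(N : ℝ)|) ≤
      -((S.eulerChar : ℝ) / (n : ℝ)) / (2 * (p : ℝ)) := by
    have e : -((S.eulerChar : ℝ) / (n : ℝ)) / (2 * (p : ℝ)) =
        -(S.eulerChar : ℝ) / (2 * (n * p)) := by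
      field_simp
    rw [e]
    have h0 : (0 : ℝ) ≤ ((r - 2 : ℕ) : ℝ) := Nat.cast_nonneg _
    gcongr
    exact h0.trans hrR
  have hnonneg : 0 ≤ -((S.eulerChar : ℝ) / (n : ℝ)) / (2 * (p : ℝ)) :=
    le_trans (by positivity) hbound
  have hfinal : DehnScl.scl (DehnScl.coreClass h) ≤
      ENNReal.ofReal (-((S.eulerChar : ℝ) / (n : ℝ)) / (2 * (p : ℝ))) :=
    hle.trans (ENNReal.ofReal_le_ofReal hbound)
  have hcast := EReal.coe_ennreal_le_coe_ennreal_iff.2 hfinal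
  rwa [EReal.coe_ennreal_ofReal, max_eq_left hnonneg] at hcast
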